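/- Let $d\ge 1$, $\beta_i>0$ ($i=1,\dots,d$), $\eta\ge 0$ and $0<\alpha\le\sum_{i=1}^d\beta_i-1$. Given $\lambda=(\lambda_1,\dots,\lambda_d)$, let $x=(x_1,\dots,x_d)$ (observed) and $y=(y_1,\dots,y_d)$ (to be predicted) be independent with independent coordinates $x_i\sim\mathrm{Po}(r_i\lambda_i)$ and $y_i\sim\mathrm{Po}(s_i\lambda_i)$, where $r_i,s_i>0$ are known. For a (possibly improper) prior density $\pi$ on $(0,\infty)^d$ the Bayesian predictive distribution is $$p_\pi(y\mid x)=\frac{\int p(x\mid\lambda)\,p(y\mid\lambda)\,\pi(\lambda)\,d\lambda}{\int p(x\mid\lambda)\,\pi(\lambda)\,d\lambda},$$ and the Kullback--Leibler risk at $\lambda$ of a predictive distribution $q$ is $$R(\lambda,q)=\sum_x p(x\mid\lambda)\sum_y p(y\mid\lambda)\log\frac{p(y\mid\lambda)}{q(y\mid x)}.$$ We say that $q_1$ dominates $q_2$ if both risks are finite and $R(\lambda,q_1)\le R(\lambda,q_2)$ for every $\lambda\in[0,\infty)^d$, with strict inequality for some $\lambda\in(0,\infty)^d$. Let $p_\beta$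 and $p_{f,\beta}$ be the Bayesian predictive distributions based on $$\pi_\beta(\lambda)\propto\prod_{i=1}^d\lambda_i^{\beta_i-1},\qquad \pi_{f,\beta}(\lambda)\propto f(\theta_1,\dots,\theta_d)\prod_{i=1}^d\lambda_i^{\beta_i-1},\qquad f(\theta)=\Bigl(\sum_{i=1}^d\theta_i^2+\eta\Bigr)^{-\alpha}.$$ Then the normalizing integrals of both predictive distributions are positive and finite for every $x\in\mathbb N^d$, and $p_{f,\beta}$ dominates $p_\beta$ in each of the following cases: 1. (same durations) $r_1=\dots=r_d$, $s_1=\dots=s_d$, and $\theta_i=\sqrt{\lambda_i}$; 2. (same or different durations) $r_i,s_i>0$ are arbitrary, and $\theta_i=\sqrt{\lambda_i/\gamma_i}$ with $\gamma_i=\frac1{r_i}-\frac1{r_i+s_i}$. -/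

import Mathlib

open scoped Nat

noncomputable section

namespace PoissonPrediction

variable {d : ℕ}

/-- The probability mass function at `z ∈ ℕ^d` of `d` independent Poisson variables, the
`i`-th one with mean `t i * lam i` (duration `t i`, intensity `lam i`). -/
def poissonLik (t lam : Fin d → ℝ) (z : Fin d → ℕ) : ℝ :=
  ∏ i, (t i * lam i) ^ z i / ((z i)! : ℝ) * Real.exp (-(t i * lam i))

/-- The open orthant `(0, ∞)^d`, over which priors are integrated. -/
def posOrthant (d : ℕ) : Set (Fin d → ℝ) := {lam | ∀ i, 0 < lam i}

/-- The normalizing constant `∫ p(x ∣ λ) π(λ) dλ`. -/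
def marginal (r : Fin d → ℝ) (prior : (Fin d → ℝ) → ℝ) (x : Fin d → ℕ) : ℝ :=
  ∫ lam in posOrthant d, poissonLik r lam x * prior lam

/-- The Bayesian predictive distribution
`p_π(y ∣ x) = ∫ p(x ∣ λ) p(y ∣ λ) π(λ) dλ / ∫ p(x ∣ λ) π(λ) dλ`, where `π` is a possibly improper
prior density with respect to Lebesgue measure (a constant factor in `π` cancels). -/
def predictive (r s : Fin d → ℝ) (prior : (Fin d → ℝ) → ℝ) (x y : Fin d → ℕ) : ℝ :=
  (∫ lam in posOrthant d, poissonLik r lam x * poissonLik s lam y * prior lam) /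
    marginal r prior x

/-- The posterior exists for every observation: `0 < ∫ p(x ∣ λ) π(λ) dλ < ∞`. -/
def PosteriorExists (r : Fin d → ℝ) (prior : (Fin d → ℝ) → ℝ) : Prop :=
  ∀ x : Fin d → ℕ,
    MeasureTheory.IntegrableOn (fun lam => poissonLik r lam x * prior lam) (posOrthant d) ∧
      0 < marginal r prior x

/-- The Kullback--Leibler loss `D(p, q) = ∑_y p(y) log (p(y) / q(y))`. -/
def klLoss (p q : (Fin d → ℕ) → ℝ) : ℝ := ∑' y, p y * Real.log (p y / q y)

/-- `D(p, q)` is given by an absolutely convergent series with no division by zero. -/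
def KLLossFinite (p q : (Fin d → ℕ) → ℝ) : Prop :=
  (∀ y, p y ≠ 0 → 0 < q y) ∧ Summable fun y => p y * Real.log (p y / q y)

/-- The Kullback--Leibler risk at `lam` of the predictive distribution `q`, where `q x y` stands
for `q(y ∣ x)`: the expectation over `x` of the loss `D(p(· ∣ lam), q(· ∣ x))`. -/
def klRisk (r s : Fin d → ℝ) (q : (Fin d → ℕ) → (Fin d → ℕ) → ℝ) (lam : Fin d → ℝ) : ℝ :=
  ∑' x, poissonLik r lam x * klLoss (poissonLik s lam) (q x)

/-- All the series that define `klRisk r s q lam` converge. -/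
def KLRiskFinite (r s : Fin d → ℝ) (q : (Fin d → ℕ) → (Fin d → ℕ) → ℝ)
    (lam : Fin d → ℝ) : Prop :=
  (∀ x, poissonLik r lam x ≠ 0 → KLLossFinite (poissonLik s lam) (q x)) ∧
    Summable fun x => poissonLik r lam x * klLoss (poissonLik s lam) (q x)

/-- `q₁` dominates `q₂` under Kullback--Leibler loss: both have finite risk, the risk of `q₁` is
nowhere larger than that of `q₂`, and it is strictly smaller somewhere. The comparison covers the
closed orthant and the strict inequality is asked for inside the open one, so that the definition
implies domination whether or not intensities equal to `0` are admitted as parameters. -/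
def Dominates (r s : Fin d → ℝ) (q₁ q₂ : (Fin d → ℕ) → (Fin d → ℕ) → ℝ) : Prop :=
  (∀ lam : Fin d → ℝ, (∀ i, 0 ≤ lam i) →
    KLRiskFinite r s q₁ lam ∧ KLRiskFinite r s q₂ lam ∧ klRisk r s q₁ lam ≤ klRisk r s q₂ lam) ∧
  ∃ lam ∈ posOrthant d, klRisk r s q₁ lam < klRisk r s q₂ lam

/-- The prior density `π_β(λ) ∝ ∏ λ_i ^ (β_i - 1)`. -/
def priorBeta (β lam : Fin d → ℝ) : ℝ := ∏ i, lam i ^ (β i - 1)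

/-- The prior density `π_{f,β}(λ) ∝ f(θ(λ)) ∏ λ_i ^ (β_i - 1)`, for a reparametrization
`λ ↦ θ(λ)`. -/
def priorF (f : (Fin d → ℝ) → ℝ) (θ : (Fin d → ℝ) → Fin d → ℝ) (β lam : Fin d → ℝ) : ℝ :=
  f (θ lam) * priorBeta β lam

/-- `θ_i = √λ_i`, used when all durations are the same. -/
def thetaSame (lam : Fin d → ℝ) : Fin d → ℝ := fun i => Real.sqrt (lam i)

/-- `γ_i = 1 / r_i - 1 / (r_i + s_i)`. -/
def gam (r s : Fin d → ℝ) : Fin d → ℝ := fun i => 1 / r i - 1 / (r i + s i)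

/-- `θ_i = √(λ_i / γ_i)`, used for different durations. -/
def thetaDiff (r s lam : Fin d → ℝ) : Fin d → ℝ := fun i => Real.sqrt (lam i / gam r s i)

/-- The shift point shrinkage function `f(θ) = (∑ θ_i ^ 2 + η) ^ (-α)`. -/
def shiftPoint (η α : ℝ) (θ : Fin d → ℝ) : ℝ := (∑ i, θ i ^ 2 + η) ^ (-α)

end PoissonPrediction

end

namespace PoissonPrediction

open MeasureTheory Set Filter Topology

variable {d : ℕ}

/-! Write `S_c(z)` for `shrinkInt η c (shape β z) α`, and let `θ_i ^ 2 = w_i λ_i`. Representing `(∑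
w_i λ_i + η) ^ (-α)` as a Laplace integral and using Gamma conjugacy, the predictive distribution of
the shrinkage prior is that of `π_β` times `S_{c'}(x + y) / S_c(x)`, where `c_i = w_i / r_i` and
`c'_i = w_i / (r_i + s_i)` (`predictive_priorF`). The risk gain is therefore `E log S_{c'}(x + y) -
E log S_c(x)`. Both terms have the form `E log S_c(z)` with `z_i ∼ Po(μ_i / c_i)` and the same `μ_i
= w_i λ_i`; in both cases of the theorem `w` makes `c_i - c'_i` a constant `δ > 0`. It remains to
see that this expectation strictly decreases along `c ↦ c + σ` (`tsum_poissonLik_logShrink_lt`).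

The Poisson identity `E[z_i h(z)] = (μ_i / c_i) E[h(z + e_i)]` turns the derivative into the
expectation of `logDrift`. Bounding the backward log-ratios by `log u ≤ u - 1` leaves `S⁻¹ ∑ c_i⁻¹
(z_i ∇⁻S + (z_i + β_i) ∇⁺S)`, which is nonpositive for `z ≠ 0` (`sum_shrinkInt_nonpos`): an
integration by parts in `v` reduces the sum to `(α + 1 - ∑ β_i)` times a nonnegative integral, minus
another nonnegative term. At `z = 0` the drift is strictly negative, and `0` always has positive
probability.

The analytic steps rest on growth bounds of the form `C * 2 ^ ∑ z_i`, which Poisson weights make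
summable. -/

/-! ### The shrinkage integrals and their recurrences. -/

/-- The integrand `v ^ (p - 1) e ^ (-η v) ∏ (1 + c i v) ^ (-a i)`. -/
noncomputable def shrinkKernel (η : ℝ) (c a : Fin d → ℝ) (p v : ℝ) : ℝ :=
  v ^ (p - 1) * Real.exp (-(η * v + ∑ i, a i * Real.log (1 + c i * v)))

/-- The integral `∫₀^∞ v ^ (p - 1) e ^ (-η v) ∏ (1 + c i v) ^ (-a i) dv`. -/
noncomputable def shrinkInt (η : ℝ) (c a : Fin d → ℝ) (p : ℝ) : ℝ :=
  ∫ v in Ioi (0 : ℝ), shrinkKernel η c a p v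

lemma measurable_shrinkKernel (η : ℝ) (c a : Fin d → ℝ) (p : ℝ) :
    Measurable (shrinkKernel η c a p) := by
  unfold shrinkKernel
  fun_prop

lemma shrinkKernel_pos (η : ℝ) (c a : Fin d → ℝ) (p : ℝ) {v : ℝ} (hv : 0 < v) :
    0 < shrinkKernel η c a p v :=
  mul_pos (Real.rpow_pos_of_pos hv _) (Real.exp_pos _)

lemma mul_shrinkKernel (η : ℝ) (c a : Fin d → ℝ) (p : ℝ) {v : ℝ} (hv : 0 < v) :
    v * shrinkKernel η c a p v = shrinkKernel η c a (p + 1) v := by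
  unfold shrinkKernel
  rw [show p + 1 - 1 = (p - 1) + 1 by ring, Real.rpow_add_one hv.ne']
  ring

/-- Source of every recurrence below: together with `mul_shrinkKernel` it trades factors of `v` and
`1 + c i * v` for shifts of the parameters. -/
lemma one_add_mul_shrinkKernel (η : ℝ) {c : Fin d → ℝ} (a : Fin d → ℝ) (p : ℝ) {v : ℝ} (i : Fin d)
    (hv : 0 < 1 + c i * v) :
    (1 + c i * v) * shrinkKernel η c (a + Pi.single i 1) p v = shrinkKernel η c a p v := by
  unfold shrinkKernel
  have : ∑ j, (a + Pi.single i 1 : Fin d → ℝ) j * Real.log (1 + c j * v) =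
      ∑ j, a j * Real.log (1 + c j * v) + Real.log (1 + c i * v) := by
    simp [add_mul, Finset.sum_add_distrib, Pi.single_apply]
  rw [this, show -(η * v + (∑ j, a j * Real.log (1 + c j * v) + Real.log (1 + c i * v))) =
    -(η * v + ∑ j, a j * Real.log (1 + c j * v)) - Real.log (1 + c i * v) by ring,
    Real.exp_sub, Real.exp_log hv]
  field_simp

lemma sum_mul_log_nonneg {c a : Fin d → ℝ} (hc : ∀ i, 0 < c i) (ha : ∀ i, 0 ≤ a i) {v : ℝ}
    (hv : 0 < v) : 0 ≤ ∑ i, a i * Real.log (1 + c i * v) :=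
  Finset.sum_nonneg fun i _ => mul_nonneg (ha i)
    (Real.log_nonneg (by have := mul_pos (hc i) hv; linarith))

lemma shrinkKernel_le_rpow_mul_exp (η : ℝ) {c a : Fin d → ℝ} (hc : ∀ i, 0 < c i)
    (ha : ∀ i, 0 ≤ a i) (p : ℝ) {v : ℝ} (hv : 0 < v) :
    shrinkKernel η c a p v ≤ v ^ (p - 1) * Real.exp (-(η * v)) := by
  unfold shrinkKernel
  have := sum_mul_log_nonneg hc ha hv
  gcongr
  linarith

lemma shrinkKernel_le_rpow {η : ℝ} (hη : 0 ≤ η) {c a : Fin d → ℝ} (hc : ∀ i, 0 < c i)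
    (ha : ∀ i, 0 ≤ a i) (p : ℝ) {v : ℝ} (hv : 0 < v) :
    shrinkKernel η c a p v ≤ v ^ (p - 1) := by
  refine (shrinkKernel_le_rpow_mul_exp η hc ha p hv).trans ?_
  have : Real.exp (-(η * v)) ≤ 1 := Real.exp_le_one_iff.2 (by nlinarith [mul_nonneg hη hv.le])
  exact mul_le_of_le_one_right (Real.rpow_nonneg hv.le _) this

/-- Decay at infinity, from `1 + c i * v ≥ c i * v`. -/
lemma shrinkKernel_le_mul_rpow {η : ℝ} (hη : 0 ≤ η) {c a : Fin d → ℝ} (hc : ∀ i, 0 < c i)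
    (ha : ∀ i, 0 ≤ a i) (p : ℝ) {v : ℝ} (hv : 0 < v) :
    shrinkKernel η c a p v ≤
      Real.exp (-∑ i, a i * Real.log (c i)) * v ^ (p - 1 - ∑ i, a i) := by
  unfold shrinkKernel
  rw [Real.rpow_sub hv (p - 1), div_eq_mul_inv, ← Real.rpow_neg hv.le, Real.rpow_def_of_pos hv (-∑ i, a i),
    mul_left_comm, ← Real.exp_add]
  have h : ∑ i, a i * Real.log (c i) + Real.log v * ∑ i, a i ≤
      ∑ i, a i * Real.log (1 + c i * v) := by
    rw [Finset.mul_sum, ← Finset.sum_add_distrib]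
    refine Finset.sum_le_sum fun i _ => ?_
    have := Real.log_le_log (mul_pos (hc i) hv) (show c i * v ≤ 1 + c i * v by linarith)
    rw [Real.log_mul (hc i).ne' hv.ne'] at this
    nlinarith [mul_le_mul_of_nonneg_left this (ha i)]
  have : 0 ≤ η * v := mul_nonneg hη hv.le
  gcongr
  linarith

lemma integrableOn_shrinkKernel {η : ℝ} (hη : 0 ≤ η) {c a : Fin d → ℝ} (hc : ∀ i, 0 < c i)
    (ha : ∀ i, 0 ≤ a i) {p : ℝ} (hp : 0 < p) (hpa : p < ∑ i, a i) :
    IntegrableOn (shrinkKernel η c a p) (Ioi 0) := by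
  rw [← Ioc_union_Ioi_eq_Ioi (zero_le_one' ℝ)]
  refine IntegrableOn.union ?_ ?_
  · have h : IntegrableOn (fun v : ℝ => v ^ (p - 1)) (Ioc 0 1) := by
      rw [← intervalIntegrable_iff_integrableOn_Ioc_of_le zero_le_one]
      exact intervalIntegral.intervalIntegrable_rpow' (by linarith)
    refine h.mono' (measurable_shrinkKernel ..).aestronglyMeasurable ?_
    refine (ae_restrict_mem measurableSet_Ioc).mono fun v hv => ?_
    rw [Real.norm_of_nonneg (shrinkKernel_pos η c a p hv.1).le]
    exact shrinkKernel_le_rpow hη hc ha p hv.1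
  · have h : IntegrableOn (fun v : ℝ => Real.exp (-∑ i, a i * Real.log (c i)) *
        v ^ (p - 1 - ∑ i, a i)) (Ioi 1) :=
      (integrableOn_Ioi_rpow_of_lt (by linarith) one_pos).const_mul _
    refine h.mono' (measurable_shrinkKernel ..).aestronglyMeasurable ?_
    refine (ae_restrict_mem measurableSet_Ioi).mono fun v hv => ?_
    have hv0 : (0 : ℝ) < v := one_pos.trans hv
    rw [Real.norm_of_nonneg (shrinkKernel_pos η c a p hv0).le]
    exact shrinkKernel_le_mul_rpow hη hc ha p hv0

/-- No upper bound on `p` is needed: for `η = 0` the function vanishes, and for `η > 0` the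
exponential gives integrability. The integration by parts uses this at an exponent that may exceed
`∑ a i`. -/
lemma integrableOn_const_mul_shrinkKernel {η : ℝ} (hη : 0 ≤ η) {c a : Fin d → ℝ}
    (hc : ∀ i, 0 < c i) (ha : ∀ i, 0 ≤ a i) {p : ℝ} (hp : 0 < p) :
    IntegrableOn (fun v => η * shrinkKernel η c a p v) (Ioi 0) := by
  rcases hη.eq_or_lt with rfl | hη
  · simp
  refine Integrable.const_mul ?_ η
  have h := integrableOn_rpow_mul_exp_neg_mul_rpow (p := 1) (s := p - 1) (b := η)
    (by linarith) one_pos hη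
  refine Integrable.mono' h (measurable_shrinkKernel ..).aestronglyMeasurable ?_
  refine (ae_restrict_mem measurableSet_Ioi).mono fun v hv => ?_
  rw [Real.norm_of_nonneg (shrinkKernel_pos η c a p hv).le]
  simpa [Real.rpow_one] using shrinkKernel_le_rpow_mul_exp η hc ha p hv

lemma setIntegral_pos_of_forall_pos {g : ℝ → ℝ} {s : Set ℝ} (hs : MeasurableSet s) (hs0 : volume s ≠ 0)
    (hg : IntegrableOn g s) (h : ∀ v ∈ s, 0 < g v) : 0 < ∫ v in s, g v := by
  rw [setIntegral_pos_iff_support_of_nonneg_ae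
    ((ae_restrict_mem hs).mono fun v hv => (h v hv).le) hg]
  rw [inter_eq_self_of_subset_right (show s ⊆ Function.support g from fun v hv => (h v hv).ne')]
  exact pos_iff_ne_zero.2 hs0

lemma shrinkInt_pos {η : ℝ} (hη : 0 ≤ η) {c a : Fin d → ℝ} (hc : ∀ i, 0 < c i)
    (ha : ∀ i, 0 ≤ a i) {p : ℝ} (hp : 0 < p) (hpa : p < ∑ i, a i) : 0 < shrinkInt η c a p :=
  setIntegral_pos_of_forall_pos measurableSet_Ioi (by simp) (integrableOn_shrinkKernel hη hc ha hp hpa)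
    fun _ hv => shrinkKernel_pos η c a p hv

lemma shrinkInt_nonneg (η : ℝ) (c a : Fin d → ℝ) (p : ℝ) : 0 ≤ shrinkInt η c a p :=
  setIntegral_nonneg measurableSet_Ioi fun _ hv => (shrinkKernel_pos η c a p hv).le

lemma sum_add_single (a : Fin d → ℝ) (i : Fin d) (t : ℝ) :
    ∑ j, (a + Pi.single i t : Fin d → ℝ) j = ∑ j, a j + t := by
  simp [Finset.sum_add_distrib]

lemma add_single_nonneg {a : Fin d → ℝ} (ha : ∀ i, 0 ≤ a i) (i j : Fin d) :
    0 ≤ (a + Pi.single i 1 : Fin d → ℝ) j :=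
  add_nonneg (ha j) ((Pi.single_nonneg.2 zero_le_one : (0 : Fin d → ℝ) ≤ Pi.single i 1) j)

lemma shrinkInt_sub_shrinkInt {η : ℝ} (hη : 0 ≤ η) {c a : Fin d → ℝ} (hc : ∀ i, 0 < c i)
    (ha : ∀ i, 0 ≤ a i) {p : ℝ} (hp : 0 < p) (hpa : p < ∑ i, a i) (i : Fin d) :
    shrinkInt η c a p - shrinkInt η c (a + Pi.single i 1) p =
      c i * shrinkInt η c (a + Pi.single i 1) (p + 1) := by
  unfold shrinkInt
  rw [← integral_sub (integrableOn_shrinkKernel hη hc ha hp hpa)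
    (integrableOn_shrinkKernel hη hc (add_single_nonneg ha i) hp
      (by rw [sum_add_single]; linarith)), ← integral_const_mul]
  refine setIntegral_congr_fun measurableSet_Ioi fun v hv => ?_
  have hv : 0 < v := hv
  have := one_add_mul_shrinkKernel η (c := c) (v := v) a p i (by have := mul_pos (hc i) hv; linarith)
  rw [← mul_shrinkKernel _ _ _ _ hv, ← this]
  ring

/-- The logarithmic derivative of `(1 + c i * v) ^ (-a i)`, times `v`, is `-a i * (1 - 1 / (1 + c i
* v))`; this is why only kernels with one raised shape appear. -/
lemma hasDerivAt_shrinkKernel (η : ℝ) {c : Fin d → ℝ} (hc : ∀ i, 0 < c i) (a : Fin d → ℝ) (p : ℝ)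
    {v : ℝ} (hv : 0 < v) :
    HasDerivAt (shrinkKernel η c a (p + 1))
      (p * shrinkKernel η c a p v - η * shrinkKernel η c a (p + 1) v -
        ∑ i, a i * (shrinkKernel η c a p v - shrinkKernel η c (a + Pi.single i 1) p v)) v := by
  have hpos : ∀ i, 0 < 1 + c i * v := fun i => by have := mul_pos (hc i) hv; linarith
  have h1 : HasDerivAt (fun v : ℝ => v ^ (p + 1 - 1)) ((p + 1 - 1) * v ^ (p + 1 - 1 - 1)) v :=
    Real.hasDerivAt_rpow_const (Or.inl hv.ne')
  have h2 : ∀ i, HasDerivAt (fun v : ℝ => a i * Real.log (1 + c i * v))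
      (a i * (c i / (1 + c i * v))) v := fun i => by
    have : HasDerivAt (fun v : ℝ => 1 + c i * v) (c i) v := by
      simpa using ((hasDerivAt_id v).const_mul (c i)).const_add 1
    exact (this.log (hpos i).ne').const_mul _
  have h3 : HasDerivAt (fun v : ℝ => -(η * v + ∑ i, a i * Real.log (1 + c i * v)))
      (-(η + ∑ i, a i * (c i / (1 + c i * v)))) v := by
    have := ((hasDerivAt_id v).const_mul η).add (HasDerivAt.fun_sum fun i (_ : i ∈ Finset.univ) => h2 i)
    simpa using! this.neg
  have h4 := h1.mul h3.exp
  refine h4.congr_deriv ?_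
  have h5 : ∀ i, shrinkKernel η c a p v - shrinkKernel η c (a + Pi.single i 1) p v =
      c i / (1 + c i * v) * (v * shrinkKernel η c a p v) := fun i => by
    have := hpos i
    rw [← one_add_mul_shrinkKernel η a p i (hpos i)]
    field_simp
    ring
  simp_rw [h5, ← mul_assoc, ← Finset.sum_mul]
  rw [← mul_shrinkKernel _ _ _ _ hv]
  unfold shrinkKernel
  have : v ^ p = v ^ (p - 1) * v := by
    rw [← Real.rpow_add_one hv.ne']; congr 1; ring
  rw [show p + 1 - 1 = p by ring, this]
  ring

/-- Integration by parts: the derivative of the kernel with exponent `p + 1` integrates to zero, the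
boundary terms vanishing because `0 < p` and `p < ∑ a i`. -/
lemma sum_mul_shrinkInt_add_single {η : ℝ} (hη : 0 ≤ η) {c a : Fin d → ℝ} (hc : ∀ i, 0 < c i)
    (ha : ∀ i, 0 ≤ a i) {p : ℝ} (hp : 0 < p) (hpa : p < ∑ i, a i) :
    ∑ i, a i * shrinkInt η c (a + Pi.single i 1) p =
      (∑ i, a i - p) * shrinkInt η c a p + η * shrinkInt η c a (p + 1) := by
  have hI := integrableOn_shrinkKernel hη hc ha hp hpa
  have hJ : ∀ i, IntegrableOn (shrinkKernel η c (a + Pi.single i 1) p) (Ioi 0) := fun i =>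
    integrableOn_shrinkKernel hη hc (add_single_nonneg ha i) hp (by rw [sum_add_single]; linarith)
  have hE := integrableOn_const_mul_shrinkKernel hη hc ha (p := p + 1) (by linarith)
  have hS' : ∀ i ∈ Finset.univ, IntegrableOn (fun v => a i * (shrinkKernel η c a p v -
      shrinkKernel η c (a + Pi.single i 1) p v)) (Ioi 0) :=
    fun i _ => (hI.sub (hJ i)).const_mul (a i)
  have hS : IntegrableOn (fun v => ∑ i, a i * (shrinkKernel η c a p v -
      shrinkKernel η c (a + Pi.single i 1) p v)) (Ioi 0) :=
    integrable_finsetSum _ hS'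
  have hzero : shrinkKernel η c a (p + 1) 0 = 0 := by
    simp [shrinkKernel, Real.zero_rpow hp.ne']
  have hcont : ContinuousWithinAt (shrinkKernel η c a (p + 1)) (Ici 0) 0 := by
    refine ContinuousAt.continuousWithinAt ?_
    unfold shrinkKernel
    refine ContinuousAt.mul ?_ ?_
    · exact Real.continuousAt_rpow_const _ _ (Or.inr (by linarith))
    · refine Real.continuous_exp.continuousAt.comp (ContinuousAt.neg (ContinuousAt.add (by fun_prop) ?_))
      refine tendsto_finsetSum _ fun i _ => ?_
      refine ContinuousAt.mul (by fun_prop) (ContinuousAt.log (by fun_prop) (by simp))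
  have htop : Tendsto (shrinkKernel η c a (p + 1)) atTop (𝓝 0) := by
    have h1 : Tendsto (fun v : ℝ => Real.exp (-∑ i, a i * Real.log (c i)) *
        v ^ (-(∑ i, a i - p))) atTop (𝓝 0) := by
      simpa using (tendsto_rpow_neg_atTop (sub_pos.2 hpa)).const_mul
        (Real.exp (-∑ i, a i * Real.log (c i)))
    refine squeeze_zero' ?_ ?_ h1
    · filter_upwards [eventually_gt_atTop 0] with v hv using (shrinkKernel_pos η c a _ hv).le
    · filter_upwards [eventually_gt_atTop 0] with v hv
      refine (shrinkKernel_le_mul_rpow hη hc ha (p + 1) hv).trans_eq ?_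
      congr 2; ring
  have := integral_Ioi_of_hasDerivAt_of_tendsto hcont
    (fun v hv => hasDerivAt_shrinkKernel η hc a p hv) (((hI.const_mul p).sub hE).sub hS) htop
  have hI' : IntegrableOn (fun v => p * shrinkKernel η c a p v -
      η * shrinkKernel η c a (p + 1) v) (Ioi 0) := (hI.const_mul p).sub hE
  rw [hzero, integral_sub hI' hS, integral_sub (hI.const_mul p) hE,
    integral_const_mul, integral_const_mul,
    integral_finsetSum _ hS'] at this
  simp_rw [integral_const_mul] at this
  have h6 : ∀ i, ∫ v in Ioi 0, (shrinkKernel η c a p v - shrinkKernel η c (a + Pi.single i 1) p v)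
      = shrinkInt η c a p - shrinkInt η c (a + Pi.single i 1) p := fun i => integral_sub hI (hJ i)
  simp_rw [h6, mul_sub, Finset.sum_sub_distrib, ← Finset.sum_mul] at this
  unfold shrinkInt at *
  linarith

/-! ### Superharmonicity in the count variable. -/

/-- The shifted parameter `z i + β i`. -/
def shape (β : Fin d → ℝ) (z : Fin d → ℕ) : Fin d → ℝ := fun i => z i + β i

lemma shape_add_single (β : Fin d → ℝ) (z : Fin d → ℕ) (i : Fin d) :
    shape β (z + Pi.single i 1) = shape β z + Pi.single i 1 := by
  ext j
  by_cases h : j = i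
  · subst h; simp [shape]; ring
  · simp [shape, h]

lemma shape_nonneg {β : Fin d → ℝ} (hβ : ∀ i, 0 < β i) (z : Fin d → ℕ) (i : Fin d) :
    0 ≤ shape β z i := add_nonneg (Nat.cast_nonneg _) (hβ i).le

lemma shape_pos {β : Fin d → ℝ} (hβ : ∀ i, 0 < β i) (z : Fin d → ℕ) (i : Fin d) :
    0 < shape β z i := add_pos_of_nonneg_of_pos (Nat.cast_nonneg _) (hβ i)

lemma sum_shape (β : Fin d → ℝ) (z : Fin d → ℕ) :
    ∑ i, shape β z i = ∑ i, (z i : ℝ) + ∑ i, β i := by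
  simp [shape, Finset.sum_add_distrib]

lemma lt_sum_shape {β : Fin d → ℝ} {α : ℝ} (hαβ : α ≤ ∑ i, β i - 1) (z : Fin d → ℕ) :
    α < ∑ i, shape β z i := by
  have : 0 ≤ ∑ i, (z i : ℝ) := by positivity
  rw [sum_shape]; linarith

lemma sub_single_add_single {z : Fin d → ℕ} {i : Fin d} (h : z i ≠ 0) :
    z - Pi.single i 1 + Pi.single i 1 = z := by
  ext j
  by_cases hj : j = i
  · subst hj; simp; omega
  · simp [hj]

/-- `shrinkInt`, as a function of `z`, is superharmonic for the generator
`∑ c i ⁻¹ (z i ∇⁻ + (z i + β i) ∇⁺)`. -/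
lemma sum_shrinkInt_nonpos {η : ℝ} (hη : 0 ≤ η) {c β : Fin d → ℝ} (hc : ∀ i, 0 < c i)
    (hβ : ∀ i, 0 < β i) {α : ℝ} (hα : 0 < α) (hαβ : α ≤ ∑ i, β i - 1) {z : Fin d → ℕ}
    (hz : z ≠ 0) :
    ∑ i, (c i)⁻¹ * (z i * (shrinkInt η c (shape β z - Pi.single i 1) α -
      shrinkInt η c (shape β z) α) + shape β z i *
      (shrinkInt η c (shape β z + Pi.single i 1) α - shrinkInt η c (shape β z) α)) ≤ 0 := by
  have hz1 : (1 : ℝ) ≤ ∑ i, (z i : ℝ) := by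
    obtain ⟨i, hi⟩ := Function.ne_iff.1 hz
    have h1 : (1 : ℝ) ≤ z i := by exact_mod_cast Nat.one_le_iff_ne_zero.2 hi
    exact h1.trans (Finset.single_le_sum (f := fun i => (z i : ℝ)) (fun _ _ => by positivity) (Finset.mem_univ i))
  -- Both differences become integrals with exponent `α + 1`, and the factor `c i` they produce
  -- cancels `(c i)⁻¹`.
  have hterm : ∀ i, (c i)⁻¹ * (z i * (shrinkInt η c (shape β z - Pi.single i 1) α -
      shrinkInt η c (shape β z) α) + shape β z i *
      (shrinkInt η c (shape β z + Pi.single i 1) α - shrinkInt η c (shape β z) α)) =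
      z i * shrinkInt η c (shape β z) (α + 1) -
        shape β z i * shrinkInt η c (shape β z + Pi.single i 1) (α + 1) := by
    intro i
    have hci := (hc i).ne'
    have h1 := shrinkInt_sub_shrinkInt hη hc (shape_nonneg hβ z) hα (lt_sum_shape hαβ z) i
    have h2 : (z i : ℝ) * (shrinkInt η c (shape β z - Pi.single i 1) α -
        shrinkInt η c (shape β z) α) = z i * (c i * shrinkInt η c (shape β z) (α + 1)) := by
      -- For `z i = 0` the lowered shape may be negative, but its coefficient is zero.
      rcases Nat.eq_zero_or_pos (z i) with h | h
      · simp [h]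
      have hs := sub_single_add_single (z := z) (i := i) (by omega)
      have hs' : shape β z - Pi.single i 1 = shape β (z - Pi.single i 1) := by
        rw [sub_eq_iff_eq_add, ← shape_add_single, hs]
      have := shrinkInt_sub_shrinkInt hη hc (shape_nonneg hβ (z - Pi.single i 1)) hα
        (lt_sum_shape hαβ _) i
      rw [← shape_add_single, hs] at this
      rw [hs', this]
    rw [h2, ← neg_sub (shrinkInt η c (shape β z) α), h1]
    field_simp
    ring
  -- The recurrence at exponent `α + 1` needs `α + 1 < ∑ z i + ∑ β i`. With equality allowed in
  -- `hαβ`, this is where `z ≠ 0` is used.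
  rw [Finset.sum_congr rfl fun i _ => hterm i, Finset.sum_sub_distrib, ← Finset.sum_mul,
    sum_mul_shrinkInt_add_single hη hc (shape_nonneg hβ z) (by linarith)
      (by rw [sum_shape]; linarith), sum_shape]
  have h1 := shrinkInt_nonneg η c (shape β z) (α + 1)
  have h2 := mul_nonneg hη (shrinkInt_nonneg η c (shape β z) (α + 1 + 1))
  nlinarith

/-! ### Monotonicity and growth of the shrinkage integrals. -/

lemma shrinkKernel_le_of_le {η : ℝ} {b c a a' : Fin d → ℝ} (hb : ∀ i, 0 < b i)
    (hbc : ∀ i, b i ≤ c i) (ha : ∀ i, 0 ≤ a i) (haa' : ∀ i, a i ≤ a' i) (p : ℝ) {v : ℝ}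
    (hv : 0 < v) : shrinkKernel η c a' p v ≤ shrinkKernel η b a p v := by
  unfold shrinkKernel
  have : ∑ i, a i * Real.log (1 + b i * v) ≤ ∑ i, a' i * Real.log (1 + c i * v) := by
    refine Finset.sum_le_sum fun i _ => ?_
    have h0 : 0 < b i * v := mul_pos (hb i) hv
    have h1 : b i * v ≤ c i * v := mul_le_mul_of_nonneg_right (hbc i) hv.le
    exact mul_le_mul (haa' i) (Real.log_le_log (by linarith) (by linarith))
      (Real.log_nonneg (by linarith)) ((ha i).trans (haa' i))
  gcongr

lemma shrinkInt_le_of_le {η : ℝ} (hη : 0 ≤ η) {b c a a' : Fin d → ℝ} (hb : ∀ i, 0 < b i)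
    (hbc : ∀ i, b i ≤ c i) (ha : ∀ i, 0 ≤ a i) (haa' : ∀ i, a i ≤ a' i) {p : ℝ} (hp : 0 < p)
    (hpa : p < ∑ i, a i) : shrinkInt η c a' p ≤ shrinkInt η b a p :=
  setIntegral_mono_on
    (integrableOn_shrinkKernel hη (fun i => (hb i).trans_le (hbc i))
      (fun i => (ha i).trans (haa' i)) hp (hpa.trans_le (Finset.sum_le_sum fun i _ => haa' i)))
    (integrableOn_shrinkKernel hη hb ha hp hpa) measurableSet_Ioi
    fun _ hv => shrinkKernel_le_of_le hb hbc ha haa' p hv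

lemma sum_mul_le_mul_two_pow (z : Fin d → ℕ) {u : Fin d → ℝ} (hu : ∀ i, 0 ≤ u i) :
    ∑ i, z i * u i ≤ (∑ i, u i) * 2 ^ ∑ i, z i := by
  rw [Finset.sum_mul]
  refine Finset.sum_le_sum fun i _ => ?_
  rw [mul_comm]
  refine mul_le_mul_of_nonneg_left ?_ (hu i)
  have h1 : z i ≤ ∑ i, z i := Finset.single_le_sum (fun _ _ => Nat.zero_le _) (Finset.mem_univ i)
  exact_mod_cast h1.trans Nat.lt_two_pow_self.le

/-- From above, the integral is largest at `z = 0`. From below, restricting to `v ≤ 1` costs at most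
`∏ (1 + c i) ^ (-z i)`, so the logarithm grows at most linearly in `z`. -/
lemma exists_abs_log_shrinkInt_le {η : ℝ} (hη : 0 ≤ η) {c β : Fin d → ℝ} (hc : ∀ i, 0 < c i)
    (hβ : ∀ i, 0 < β i) {α : ℝ} (hα : 0 < α) (hαβ : α ≤ ∑ i, β i - 1) :
    ∃ C, 0 ≤ C ∧ ∀ z, |Real.log (shrinkInt η c (shape β z) α)| ≤ C * 2 ^ ∑ i, z i := by
  set A := ∫ v in Ioc (0 : ℝ) 1, shrinkKernel η c (shape β 0) α v with hA
  have hint : ∀ z, IntegrableOn (shrinkKernel η c (shape β z) α) (Ioi 0) := fun z =>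
    integrableOn_shrinkKernel hη hc (shape_nonneg hβ z) hα (lt_sum_shape hαβ z)
  have hApos : 0 < A := setIntegral_pos_of_forall_pos measurableSet_Ioc (by simp)
    ((hint 0).mono_set Ioc_subset_Ioi_self) fun v hv => shrinkKernel_pos _ _ _ _ hv.1
  have hlogc : ∀ i, 0 ≤ Real.log (1 + c i) := fun i => Real.log_nonneg (by linarith [hc i])
  refine ⟨|Real.log (shrinkInt η c (shape β 0) α)| + |Real.log A| + ∑ i, Real.log (1 + c i),
    add_nonneg (by positivity) (Finset.sum_nonneg fun i _ => hlogc i), fun z => ?_⟩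
  have hup : shrinkInt η c (shape β z) α ≤ shrinkInt η c (shape β 0) α :=
    shrinkInt_le_of_le hη hc (fun _ => le_rfl) (shape_nonneg hβ 0) (fun i => by simp [shape]) hα
      (lt_sum_shape hαβ 0)
  have hlow : A * Real.exp (-∑ i, z i * Real.log (1 + c i)) ≤ shrinkInt η c (shape β z) α := by
    rw [hA, ← integral_mul_const]
    refine le_trans (setIntegral_mono_on (((hint 0).mono_set Ioc_subset_Ioi_self).mul_const _)
      ((hint z).mono_set Ioc_subset_Ioi_self) measurableSet_Ioc fun v hv => ?_)
      (setIntegral_mono_set (hint z) ((ae_restrict_mem measurableSet_Ioi).mono fun v hv =>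
        (shrinkKernel_pos _ _ _ _ hv).le) (Eventually.of_forall Ioc_subset_Ioi_self))
    unfold shrinkKernel
    rw [mul_assoc, ← Real.exp_add]
    have : ∑ i, shape β z i * Real.log (1 + c i * v) ≤
        ∑ i, shape β 0 i * Real.log (1 + c i * v) + ∑ i, z i * Real.log (1 + c i) := by
      rw [← Finset.sum_add_distrib]
      refine Finset.sum_le_sum fun i _ => ?_
      have h0 : 0 < c i * v := mul_pos (hc i) hv.1
      have h1 : c i * v ≤ c i := mul_le_of_le_one_right (hc i).le hv.2
      have := Real.log_le_log (x := 1 + c i * v) (y := 1 + c i) (by linarith) (by linarith)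
      have := mul_le_mul_of_nonneg_left this (Nat.cast_nonneg (α := ℝ) (z i))
      simp only [shape, Pi.zero_apply, Nat.cast_zero, zero_add]
      linarith
    have : 0 ≤ v ^ (α - 1) := Real.rpow_nonneg hv.1.le _
    gcongr
    linarith
  have hpos := shrinkInt_pos hη hc (shape_nonneg hβ z) hα (lt_sum_shape hαβ z)
  have h1 := Real.log_le_log hpos hup
  have h2 := Real.log_le_log (by positivity) hlow
  rw [Real.log_mul hApos.ne' (Real.exp_ne_zero _), Real.log_exp] at h2
  have h3 := sum_mul_le_mul_two_pow z hlogc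
  have h4 : (1 : ℝ) ≤ 2 ^ ∑ i, z i := one_le_pow₀ one_le_two
  have h5 := mul_le_mul_of_nonneg_left h4 (abs_nonneg (Real.log A))
  have h6 := mul_le_mul_of_nonneg_left h4 (abs_nonneg (Real.log (shrinkInt η c (shape β 0) α)))
  have h7 := Finset.sum_nonneg fun i (_ : i ∈ Finset.univ) =>
    mul_nonneg (Nat.cast_nonneg (α := ℝ) (z i)) (hlogc i)
  rw [abs_le]
  constructor
  · linarith [neg_abs_le (Real.log A), abs_nonneg (Real.log (shrinkInt η c (shape β 0) α))]
  · linarith [le_abs_self (Real.log (shrinkInt η c (shape β 0) α)), abs_nonneg (Real.log A)]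

/-! ### Differentiating the shrinkage integrals along a common shift of `c`. -/

lemma hasDerivAt_shrinkKernel_shift (η : ℝ) {b : Fin d → ℝ} (hb : ∀ i, 0 < b i) (a : Fin d → ℝ)
    (p : ℝ) {v σ : ℝ} (hv : 0 < v) (hσ : 0 < σ) :
    HasDerivAt (fun σ => shrinkKernel η (fun i => b i + σ) a p v)
      (∑ i, a i * (b i + σ)⁻¹ * (shrinkKernel η (fun i => b i + σ) (a + Pi.single i 1) p v -
        shrinkKernel η (fun i => b i + σ) a p v)) σ := by
  have hc : ∀ i, 0 < b i + σ := fun i => add_pos (hb i) hσ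
  have hpos : ∀ i, 0 < 1 + (b i + σ) * v := fun i => by have := mul_pos (hc i) hv; linarith
  have h2 : ∀ i, HasDerivAt (fun σ : ℝ => a i * Real.log (1 + (b i + σ) * v))
      (a i * (v / (1 + (b i + σ) * v))) σ := fun i => by
    have : HasDerivAt (fun σ : ℝ => 1 + (b i + σ) * v) v σ := by
      simpa using (((hasDerivAt_id σ).const_add (b i)).mul_const v).const_add 1
    exact (this.log (hpos i).ne').const_mul _
  have h3 : HasDerivAt (fun σ : ℝ => -(η * v + ∑ i, a i * Real.log (1 + (b i + σ) * v)))
      (-∑ i, a i * (v / (1 + (b i + σ) * v))) σ :=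
    ((HasDerivAt.fun_sum fun i (_ : i ∈ Finset.univ) => h2 i).const_add _).neg
  refine (h3.exp.const_mul (v ^ (p - 1))).congr_deriv ?_
  rw [← mul_assoc, mul_neg, Finset.mul_sum, ← Finset.sum_neg_distrib]
  refine Finset.sum_congr rfl fun i _ => ?_
  change -(shrinkKernel η (fun i => b i + σ) a p v * _) = _
  rw [← one_add_mul_shrinkKernel η (c := fun i => b i + σ) a p i (hpos i)]
  have := hpos i
  have := hc i
  field_simp
  ring

lemma abs_shrinkKernel_sub_le (η : ℝ) {b a : Fin d → ℝ} (hb : ∀ i, 0 < b i)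
    (ha : ∀ i, 0 ≤ a i) (p : ℝ) {v σ : ℝ} (hv : 0 < v) (hσ : 0 < σ) (i : Fin d) :
    |shrinkKernel η (fun i => b i + σ) (a + Pi.single i 1) p v -
        shrinkKernel η (fun i => b i + σ) a p v| ≤ shrinkKernel η b a p v := by
  have h1 := shrinkKernel_le_of_le (η := η) (c := fun i => b i + σ) (a' := a) hb
    (fun i => by linarith) ha (fun _ => le_rfl) p hv
  have h2 := shrinkKernel_le_of_le (η := η) (c := fun i => b i + σ) (fun i => add_pos (hb i) hσ)
    (fun i => le_rfl) ha (a' := a + Pi.single i 1) (fun j => le_add_of_nonneg_right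
      ((Pi.single_nonneg.2 zero_le_one : (0 : Fin d → ℝ) ≤ Pi.single i 1) j)) p hv
  have h3 := shrinkKernel_pos η (fun i => b i + σ) (a + Pi.single i 1) p hv
  rw [abs_le]
  constructor <;> linarith

/-- The majorant does not depend on `σ`, as differentiation under the integral requires. -/
lemma norm_deriv_shrinkKernel_le (η : ℝ) {b a : Fin d → ℝ} (hb : ∀ i, 0 < b i)
    (ha : ∀ i, 0 ≤ a i) (p : ℝ) {v σ : ℝ} (hv : 0 < v) (hσ : 0 < σ) :
    ‖∑ i, a i * (b i + σ)⁻¹ * (shrinkKernel η (fun i => b i + σ) (a + Pi.single i 1) p v -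
        shrinkKernel η (fun i => b i + σ) a p v)‖ ≤
      ∑ i, a i * (b i)⁻¹ * shrinkKernel η b a p v := by
  refine (norm_sum_le _ _).trans (Finset.sum_le_sum fun i _ => ?_)
  rw [norm_mul, norm_mul, Real.norm_of_nonneg (ha i),
    Real.norm_of_nonneg (inv_pos.2 (add_pos (hb i) hσ)).le]
  have h1 : (b i + σ)⁻¹ ≤ (b i)⁻¹ := inv_anti₀ (hb i) (by linarith)
  exact mul_le_mul (mul_le_mul_of_nonneg_left h1 (ha i))
    (abs_shrinkKernel_sub_le η hb ha p hv hσ i) (norm_nonneg _)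
    (mul_nonneg (ha i) (inv_pos.2 (hb i)).le)

lemma hasDerivAt_shrinkInt_shift {η : ℝ} (hη : 0 ≤ η) {b a : Fin d → ℝ} (hb : ∀ i, 0 < b i)
    (ha : ∀ i, 0 ≤ a i) {p : ℝ} (hp : 0 < p) (hpa : p < ∑ i, a i) {σ : ℝ} (hσ : 0 < σ) :
    HasDerivAt (fun σ => shrinkInt η (fun i => b i + σ) a p)
      (∑ i, a i * (b i + σ)⁻¹ * (shrinkInt η (fun i => b i + σ) (a + Pi.single i 1) p -
        shrinkInt η (fun i => b i + σ) a p)) σ := by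
  have hint : IntegrableOn (shrinkKernel η (fun i => b i + σ) a p) (Ioi 0) :=
    integrableOn_shrinkKernel hη (fun i => add_pos (hb i) hσ) ha hp hpa
  have hint' : ∀ i, IntegrableOn (shrinkKernel η (fun i => b i + σ) (a + Pi.single i 1) p) (Ioi 0) :=
    fun i => integrableOn_shrinkKernel hη (fun i => add_pos (hb i) hσ) (add_single_nonneg ha i) hp
      (by rw [sum_add_single]; linarith)
  have hint0 : IntegrableOn (shrinkKernel η b a p) (Ioi 0) :=
    integrableOn_shrinkKernel hη hb ha hp hpa
  have hmeas : Measurable fun v => ∑ i, a i * (b i + σ)⁻¹ *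
      (shrinkKernel η (fun i => b i + σ) (a + Pi.single i 1) p v -
        shrinkKernel η (fun i => b i + σ) a p v) :=
    Finset.measurable_fun_sum _ fun i _ =>
      ((measurable_shrinkKernel ..).sub (measurable_shrinkKernel ..)).const_mul _
  have hbound : IntegrableOn (fun v => ∑ i, a i * (b i)⁻¹ * shrinkKernel η b a p v) (Ioi 0) :=
    integrable_finsetSum _ fun i _ => hint0.const_mul _
  have hF : ∀ᶠ s in 𝓝 σ, AEStronglyMeasurable
      (fun v => shrinkKernel η (fun i => b i + s) a p v) (volume.restrict (Ioi 0)) :=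
    Eventually.of_forall fun s => (measurable_shrinkKernel ..).aestronglyMeasurable
  have hle : ∀ᵐ v ∂(volume.restrict (Ioi (0 : ℝ))), ∀ s ∈ Ioi (0 : ℝ),
      ‖∑ i, a i * (b i + s)⁻¹ * (shrinkKernel η (fun i => b i + s) (a + Pi.single i 1) p v -
        shrinkKernel η (fun i => b i + s) a p v)‖ ≤ ∑ i, a i * (b i)⁻¹ * shrinkKernel η b a p v :=
    (ae_restrict_mem measurableSet_Ioi).mono fun v hv s hs =>
      norm_deriv_shrinkKernel_le η hb ha p hv hs
  have hdiff : ∀ᵐ v ∂(volume.restrict (Ioi (0 : ℝ))), ∀ s ∈ Ioi (0 : ℝ),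
      HasDerivAt (fun s => shrinkKernel η (fun i => b i + s) a p v)
      (∑ i, a i * (b i + s)⁻¹ * (shrinkKernel η (fun i => b i + s) (a + Pi.single i 1) p v -
        shrinkKernel η (fun i => b i + s) a p v)) s :=
    (ae_restrict_mem measurableSet_Ioi).mono fun v hv s hs =>
      hasDerivAt_shrinkKernel_shift η hb a p hv hs
  have key := (hasDerivAt_integral_of_dominated_loc_of_deriv_le (Ioi_mem_nhds hσ) hF hint
    hmeas.aestronglyMeasurable hle hbound hdiff).2
  have hsum : ∀ i ∈ Finset.univ, IntegrableOn (fun v => a i * (b i + σ)⁻¹ *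
      (shrinkKernel η (fun i => b i + σ) (a + Pi.single i 1) p v -
        shrinkKernel η (fun i => b i + σ) a p v)) (Ioi 0) :=
    fun i _ => ((hint' i).sub hint).const_mul _
  refine key.congr_deriv ?_
  rw [integral_finsetSum _ hsum]
  refine Finset.sum_congr rfl fun i _ => ?_
  rw [integral_const_mul]
  exact congrArg _ (integral_sub (hint' i) hint)

/-! ### Sums against independent Poisson weights. -/

/-- Sums over boxes factor, and the boxes exhaust `ℕ ^ d`; nonnegativity upgrades this to
unconditional summability. -/
lemma hasSum_prod_pi {f : Fin d → ℕ → ℝ} (hf0 : ∀ i n, 0 ≤ f i n) (hf : ∀ i, Summable (f i)) :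
    HasSum (fun z : Fin d → ℕ => ∏ i, f i (z i)) (∏ i, ∑' n, f i n) := by
  have hbox : ∀ u : Finset (Fin d → ℕ), ∃ N, u ⊆ Fintype.piFinset fun _ => Finset.range N := by
    intro u
    refine ⟨(u.sup fun z => ∑ i, z i) + 1, fun z hz => Fintype.mem_piFinset.2 fun i => ?_⟩
    have h1 : z i ≤ ∑ i, z i := Finset.single_le_sum (fun _ _ => Nat.zero_le _) (Finset.mem_univ i)
    have h2 := Finset.le_sup (f := fun z : Fin d → ℕ => ∑ i, z i) hz
    exact Finset.mem_range.2 (Nat.lt_succ_of_le (h1.trans h2))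
  have hs : Summable (fun z : Fin d → ℕ => ∏ i, f i (z i)) := by
    refine summable_of_sum_le (c := ∏ i, ∑' n, f i n)
      (fun z => Finset.prod_nonneg fun i _ => hf0 i _) fun u => ?_
    obtain ⟨N, hN⟩ := hbox u
    refine (Finset.sum_le_sum_of_subset_of_nonneg hN fun z _ _ =>
      Finset.prod_nonneg fun i _ => hf0 i _).trans ?_
    rw [← Finset.prod_univ_sum]
    exact Finset.prod_le_prod (fun i _ => Finset.sum_nonneg fun n _ => hf0 i n)
      fun i _ => (hf i).sum_le_tsum _ fun n _ => hf0 i n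
  have hmono : Tendsto (fun N : ℕ => Fintype.piFinset fun _ : Fin d => Finset.range N)
      atTop atTop := by
    refine tendsto_atTop_finset_of_monotone (fun M N h => Fintype.piFinset_subset _ _ fun _ =>
      Finset.range_mono h) fun z => ?_
    obtain ⟨N, hN⟩ := hbox {z}
    exact ⟨N, hN (Finset.mem_singleton_self z)⟩
  have h1 := hs.hasSum.comp hmono
  have h2 : Tendsto (fun N : ℕ => ∏ i, ∑ n ∈ Finset.range N, f i n) atTop
      (𝓝 (∏ i, ∑' n, f i n)) :=
    tendsto_finsetProd _ fun i _ => (hf i).hasSum.tendsto_sum_nat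
  have h3 : (fun N : ℕ => ∏ i, ∑ n ∈ Finset.range N, f i n) =
      (fun u : Finset (Fin d → ℕ) => ∑ z ∈ u, ∏ i, f i (z i)) ∘
        fun N : ℕ => Fintype.piFinset fun _ : Fin d => Finset.range N := by
    funext N
    exact Finset.prod_univ_sum _ _
  rw [h3] at h2
  exact tendsto_nhds_unique h1 h2 ▸ hs.hasSum

lemma poissonLik_nonneg {t lam : Fin d → ℝ} (h : ∀ i, 0 ≤ t i * lam i) (z : Fin d → ℕ) :
    0 ≤ poissonLik t lam z :=
  Finset.prod_nonneg fun i _ => by have := h i; positivity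

lemma poissonLik_mul_pow (t lam : Fin d → ℝ) (K : ℝ) (z : Fin d → ℕ) :
    poissonLik t lam z * K ^ ∑ i, z i =
      ∏ i, (t i * lam i * K) ^ z i / ((z i)! : ℝ) * Real.exp (-(t i * lam i)) := by
  rw [poissonLik, ← Finset.prod_pow_eq_pow_sum, ← Finset.prod_mul_distrib]
  refine Finset.prod_congr rfl fun i _ => ?_
  rw [mul_pow]
  ring

lemma summable_poissonLik_mul_pow {t lam : Fin d → ℝ} (h : ∀ i, 0 ≤ t i * lam i) {K : ℝ}
    (hK : 0 ≤ K) : Summable fun z => poissonLik t lam z * K ^ ∑ i, z i := by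
  simp_rw [poissonLik_mul_pow]
  exact (hasSum_prod_pi (f := fun i n => (t i * lam i * K) ^ n / (n ! : ℝ) *
    Real.exp (-(t i * lam i))) (fun i n => by have := h i; positivity)
    fun i => (Real.summable_pow_div_factorial _).mul_right _).summable

lemma hasSum_poissonLik {t lam : Fin d → ℝ} (h : ∀ i, 0 ≤ t i * lam i) :
    HasSum (poissonLik t lam) 1 := by
  have := hasSum_prod_pi (f := fun i n => (t i * lam i) ^ n / (n ! : ℝ) *
    Real.exp (-(t i * lam i))) (fun i n => by have := h i; positivity)
    fun i => (Real.summable_pow_div_factorial _).mul_right _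
  convert! this using 1
  refine (Finset.prod_eq_one fun i _ => ?_).symm
  rw [tsum_mul_right, ← congrFun NormedSpace.exp_eq_tsum_div (t i * lam i), ← Real.exp_eq_exp_ℝ,
    ← Real.exp_add]
  simp

lemma summable_poissonLik_mul_of_le {t lam : Fin d → ℝ} (h : ∀ i, 0 ≤ t i * lam i)
    {g : (Fin d → ℕ) → ℝ} {C K : ℝ} (hK : 0 ≤ K) (hg : ∀ z, |g z| ≤ C * K ^ ∑ i, z i) :
    Summable fun z => poissonLik t lam z * g z := by
  refine Summable.of_norm_bounded ((summable_poissonLik_mul_pow h hK).mul_left C) fun z => ?_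
  rw [norm_mul, Real.norm_of_nonneg (poissonLik_nonneg h z), Real.norm_eq_abs]
  have := mul_le_mul_of_nonneg_left (hg z) (poissonLik_nonneg h z)
  linarith

lemma poissonLik_add_single (t lam : Fin d → ℝ) (z : Fin d → ℕ) (i : Fin d) :
    (z i + 1) * poissonLik t lam (z + Pi.single i 1) = t i * lam i * poissonLik t lam z := by
  unfold poissonLik
  rw [← Finset.mul_prod_erase _ _ (Finset.mem_univ i),
    ← Finset.mul_prod_erase (a := i) (f := fun i => (t i * lam i) ^ z i / ((z i)! : ℝ) * _)
      (h := Finset.mem_univ i)]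
  have : ∏ x ∈ Finset.univ.erase i, (t x * lam x) ^ (z + Pi.single i 1 : Fin d → ℕ) x /
      (((z + Pi.single i 1 : Fin d → ℕ) x)! : ℝ) * Real.exp (-(t x * lam x)) =
      ∏ x ∈ Finset.univ.erase i, (t x * lam x) ^ z x / ((z x)! : ℝ) * Real.exp (-(t x * lam x)) :=
    Finset.prod_congr rfl fun j hj => by simp [Finset.ne_of_mem_erase hj]
  rw [this]
  simp only [Pi.add_apply, Pi.single_eq_same, Nat.factorial_succ, Nat.cast_mul, Nat.cast_add,
    Nat.cast_one, pow_succ]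
  have h1 : (z i + 1 : ℝ) ≠ 0 := by positivity
  field_simp

/-- The Poisson analogue of Stein's identity. It is a reindexing along the injection `z ↦ z + e_i`,
whose range contains every nonzero term, so no summability is assumed. -/
lemma tsum_poissonLik_mul_coord (t lam : Fin d → ℝ) (i : Fin d) (h : (Fin d → ℕ) → ℝ) :
    ∑' z, poissonLik t lam z * (z i * h z) =
      t i * lam i * ∑' z, poissonLik t lam z * h (z + Pi.single i 1) := by
  have hinj : Function.Injective fun z : Fin d → ℕ => z + Pi.single i 1 :=
    fun _ _ h => add_right_cancel h
  rw [← hinj.tsum_eq, ← tsum_mul_left]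
  · refine tsum_congr fun z => ?_
    have := poissonLik_add_single t lam z i
    simp only [Pi.add_apply, Pi.single_eq_same, Nat.cast_add, Nat.cast_one]
    rw [← mul_assoc, ← mul_assoc, ← this]
    ring
  · intro z hz
    have hzi : z i ≠ 0 := fun h0 => hz (by simp [h0])
    refine ⟨z - Pi.single i 1, ?_⟩
    ext j
    by_cases hj : j = i
    · subst hj; simp; omega
    · simp [hj]

/-- The binomial theorem in each coordinate: a sum of independent Poisson variables is Poisson. -/
lemma sum_Iic_poissonLik_mul (t s lam : Fin d → ℝ) (z : Fin d → ℕ) :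
    ∑ x ∈ Finset.Iic z, poissonLik t lam x * poissonLik s lam (z - x) =
      poissonLik (t + s) lam z := by
  have h1 : Finset.Iic z = Fintype.piFinset fun i => Finset.Iic (z i) := by
    ext x; simp [Pi.le_def]
  unfold poissonLik
  simp_rw [← Finset.prod_mul_distrib, h1, Pi.sub_apply]
  rw [← Finset.prod_univ_sum (fun i => Finset.Iic (z i)) fun i n =>
    (t i * lam i) ^ n / (n ! : ℝ) * Real.exp (-(t i * lam i)) *
      ((s i * lam i) ^ (z i - n) / ((z i - n)! : ℝ) * Real.exp (-(s i * lam i)))]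
  refine Finset.prod_congr rfl fun i _ => ?_
  have h2 : -((t + s) i * lam i) = -(t i * lam i) + -(s i * lam i) := by
    simp only [Pi.add_apply]; ring
  rw [h2, Real.exp_add, ← Nat.range_succ_eq_Iic, Pi.add_apply, add_mul, add_pow, Finset.sum_div,
    Finset.sum_mul]
  refine Finset.sum_congr rfl fun n hn => ?_
  have hn' : n ≤ z i := Nat.lt_succ_iff.1 (Finset.mem_range.1 hn)
  rw [Nat.cast_choose ℝ hn']
  have h3 : ((z i)! : ℝ) ≠ 0 := by positivity
  field_simp

lemma tsum_poissonLik_mul_poissonLik (t s lam : Fin d → ℝ) (G : (Fin d → ℕ) → ℝ)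
    (hs : Summable fun p : (Fin d → ℕ) × (Fin d → ℕ) =>
      poissonLik t lam p.1 * poissonLik s lam p.2 * G (p.1 + p.2)) :
    ∑' p : (Fin d → ℕ) × (Fin d → ℕ),
      poissonLik t lam p.1 * poissonLik s lam p.2 * G (p.1 + p.2) =
      ∑' z, poissonLik (t + s) lam z * G z := by
  -- Group the pairs by their sum `z`; each fibre is finite, indexed by the `x ≤ z`.
  let e := Equiv.sigmaFiberEquiv fun p : (Fin d → ℕ) × (Fin d → ℕ) => p.1 + p.2
  rw [← e.tsum_eq]
  refine ((e.summable_iff).2 hs).tsum_sigma.trans ?_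
  refine tsum_congr fun z => ?_
  let e' : {x // x ∈ Finset.Iic z} ≃ {p : (Fin d → ℕ) × (Fin d → ℕ) // p.1 + p.2 = z} :=
    { toFun := fun x => ⟨(x.1, z - x.1), add_tsub_cancel_of_le (Finset.mem_Iic.1 x.2)⟩
      invFun := fun p => ⟨p.1.1, Finset.mem_Iic.2 (le_self_add.trans_eq p.2)⟩
      left_inv := fun x => rfl
      right_inv := fun p => by
        obtain ⟨⟨x, y⟩, h⟩ := p
        simp only at h
        subst h
        simp }
  rw [← e'.tsum_eq fun p => ((fun p : (Fin d → ℕ) × (Fin d → ℕ) => poissonLik t lam p.1 *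
    poissonLik s lam p.2 * G (p.1 + p.2)) ∘ e) ⟨z, p⟩, ← sum_Iic_poissonLik_mul, Finset.sum_mul, ← Finset.tsum_subtype]
  refine tsum_congr fun x => ?_
  have : x.1 + (z - x.1) = z := add_tsub_cancel_of_le (Finset.mem_Iic.1 x.2)
  change poissonLik t lam x.1 * poissonLik s lam (z - x.1) * G (x.1 + (z - x.1)) = _
  rw [this]

/-! ### Poisson weights with means `μ i / c i`, as functions of `c`. -/

lemma poissonLik_inv {c : Fin d → ℝ} (hc : ∀ i, 0 < c i) (μ : Fin d → ℝ) (z : Fin d → ℕ) :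
    poissonLik c⁻¹ μ z = (∏ i, μ i ^ z i / ((z i)! : ℝ)) *
      Real.exp (-∑ i, (z i * Real.log (c i) + (c i)⁻¹ * μ i)) := by
  rw [← Finset.sum_neg_distrib, Real.exp_sum, ← Finset.prod_mul_distrib, poissonLik]
  refine Finset.prod_congr rfl fun i _ => ?_
  have h : Real.exp (-(z i * Real.log (c i))) = (c i)⁻¹ ^ z i := by
    rw [← mul_neg, ← Real.log_inv, ← Real.log_pow, Real.exp_log (pow_pos (inv_pos.2 (hc i)) _)]
  rw [neg_add, Real.exp_add, h, Pi.inv_apply, mul_pow]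
  ring

lemma hasDerivAt_poissonLik_shift {b : Fin d → ℝ} (hb : ∀ i, 0 < b i) (μ : Fin d → ℝ)
    (z : Fin d → ℕ) {σ : ℝ} (hσ : 0 < σ) :
    HasDerivAt (fun σ => poissonLik (fun i => b i + σ)⁻¹ μ z)
      (poissonLik (fun i => b i + σ)⁻¹ μ z *
        ∑ i, (b i + σ)⁻¹ * ((b i + σ)⁻¹ * μ i - z i)) σ := by
  have hc : ∀ i, 0 < b i + σ := fun i => add_pos (hb i) hσ
  have h1 : ∀ i, HasDerivAt (fun σ => z i * Real.log (b i + σ) + (b i + σ)⁻¹ * μ i)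
      (-((b i + σ)⁻¹ * ((b i + σ)⁻¹ * μ i - z i))) σ := fun i => by
    have h := (hasDerivAt_id' σ).const_add (b i)
    refine (((h.log (hc i).ne').const_mul (z i : ℝ)).add
      ((h.inv (hc i).ne').mul_const (μ i))).congr_deriv ?_
    have := hc i
    field_simp
    ring
  have h2 := ((HasDerivAt.fun_sum fun i (_ : i ∈ Finset.univ) => h1 i).neg.exp.const_mul
    (∏ i, μ i ^ z i / ((z i)! : ℝ)))
  refine (h2.congr_of_eventuallyEq ?_).congr_deriv ?_
  · filter_upwards [Ioi_mem_nhds hσ] with s hs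
    exact poissonLik_inv (fun i => add_pos (hb i) hs) μ z
  · rw [poissonLik_inv hc, Finset.sum_neg_distrib, neg_neg, mul_assoc]
    rfl

/-- Enlarging `c` shrinks `c i ^ (-z i)`; the prefactor undoes `exp (-μ i / b i)`, while `exp (-μ i
/ c i) ≤ 1`. -/
lemma poissonLik_shift_le {b c μ : Fin d → ℝ} (hb : ∀ i, 0 < b i) (hbc : ∀ i, b i ≤ c i)
    (hμ : ∀ i, 0 ≤ μ i) (z : Fin d → ℕ) :
    poissonLik c⁻¹ μ z ≤ Real.exp (∑ i, (b i)⁻¹ * μ i) * poissonLik b⁻¹ μ z := by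
  have hc : ∀ i, 0 < c i := fun i => (hb i).trans_le (hbc i)
  rw [poissonLik_inv hb, poissonLik_inv hc, mul_left_comm, ← Real.exp_add]
  have h1 : ∑ i, z i * Real.log (b i) ≤ ∑ i, (z i * Real.log (c i) + (c i)⁻¹ * μ i) := by
    refine Finset.sum_le_sum fun i _ => ?_
    have h1 := mul_le_mul_of_nonneg_left (Real.log_le_log (hb i) (hbc i))
      (Nat.cast_nonneg (α := ℝ) (z i))
    have h2 := mul_nonneg (inv_pos.2 (hc i)).le (hμ i)
    linarith
  have h2 : 0 ≤ ∏ i, μ i ^ z i / ((z i)! : ℝ) :=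
    Finset.prod_nonneg fun i _ => by have := hμ i; positivity
  rw [Finset.sum_add_distrib] at h1
  simp only [Finset.sum_add_distrib] at *
  gcongr
  linarith

/-! ### Termwise derivative of the expected logarithm and its majorant. -/

/-- The logarithm of `shrinkInt` at the shifted parameter of `z`. -/
noncomputable def logShrink (η α : ℝ) (c β : Fin d → ℝ) (z : Fin d → ℕ) : ℝ :=
  Real.log (shrinkInt η c (shape β z) α)

/-- The derivative, along `c ↦ c + σ`, of the Poisson weight of `z` times `logShrink`. -/
noncomputable def weightedLogDeriv (η α : ℝ) (c β μ : Fin d → ℝ) (z : Fin d → ℕ) : ℝ :=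
  poissonLik c⁻¹ μ z * ((∑ i, (c i)⁻¹ * ((c i)⁻¹ * μ i - z i)) * logShrink η α c β z +
    (∑ i, shape β z i * (c i)⁻¹ * (shrinkInt η c (shape β z + Pi.single i 1) α -
      shrinkInt η c (shape β z) α)) / shrinkInt η c (shape β z) α)

section

variable {η α : ℝ} {b β μ : Fin d → ℝ}

lemma hasDerivAt_weighted_logShrink (hη : 0 ≤ η) (hα : 0 < α) (hαβ : α ≤ ∑ i, β i - 1)
    (hb : ∀ i, 0 < b i) (hβ : ∀ i, 0 < β i) (z : Fin d → ℕ) {σ : ℝ} (hσ : 0 < σ) :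
    HasDerivAt (fun σ => poissonLik (fun i => b i + σ)⁻¹ μ z *
        logShrink η α (fun i => b i + σ) β z)
      (weightedLogDeriv η α (fun i => b i + σ) β μ z) σ := by
  have hS := hasDerivAt_shrinkInt_shift hη hb (shape_nonneg hβ z) hα (lt_sum_shape hαβ z) hσ
  have hpos := shrinkInt_pos hη (fun i => add_pos (hb i) hσ) (shape_nonneg hβ z) hα
    (lt_sum_shape hαβ z)
  refine ((hasDerivAt_poissonLik_shift hb μ z hσ).mul (hS.log hpos.ne')).congr_deriv ?_
  simp only [weightedLogDeriv, logShrink]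
  ring

lemma abs_shrinkInt_ratio_le (hη : 0 ≤ η) (hα : 0 < α) (hαβ : α ≤ ∑ i, β i - 1) {c : Fin d → ℝ}
    (hc : ∀ i, 0 < c i) (hβ : ∀ i, 0 < β i) (z : Fin d → ℕ) (i : Fin d) :
    |shrinkInt η c (shape β z + Pi.single i 1) α - shrinkInt η c (shape β z) α| ≤
      shrinkInt η c (shape β z) α := by
  have h1 := shrinkInt_sub_shrinkInt hη hc (shape_nonneg hβ z) hα (lt_sum_shape hαβ z) i
  have h2 := mul_nonneg (hc i).le (shrinkInt_nonneg η c (shape β z + Pi.single i 1) (α + 1))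
  have h3 := shrinkInt_nonneg η c (shape β z + Pi.single i 1) α
  rw [abs_le]
  constructor <;> linarith

/-- The integral is antitone in `σ`, so the bounds at `b` and `b + T` control everything between. -/
lemma exists_abs_logShrink_le (hη : 0 ≤ η) (hα : 0 < α) (hαβ : α ≤ ∑ i, β i - 1)
    (hb : ∀ i, 0 < b i) (hβ : ∀ i, 0 < β i) {T : ℝ} (hT : 0 < T) :
    ∃ C, 0 ≤ C ∧ ∀ σ ∈ Ioo 0 T, ∀ z,
      |logShrink η α (fun i => b i + σ) β z| ≤ C * 2 ^ ∑ i, z i := by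
  obtain ⟨C₀, hC₀, h₀⟩ := exists_abs_log_shrinkInt_le hη hb hβ hα hαβ
  obtain ⟨C₁, hC₁, h₁⟩ := exists_abs_log_shrinkInt_le hη (fun i => add_pos (hb i) hT) hβ hα hαβ
  refine ⟨C₀ + C₁, add_nonneg hC₀ hC₁, fun σ hσ z => ?_⟩
  have hup := shrinkInt_le_of_le hη hb (c := fun i => b i + σ) (fun i => by linarith [hσ.1])
    (shape_nonneg hβ z) (fun i => le_rfl) hα (lt_sum_shape hαβ z)
  have hlow := shrinkInt_le_of_le hη (b := fun i => b i + σ) (c := fun i => b i + T)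
    (fun i => add_pos (hb i) hσ.1) (fun i => by linarith [hσ.2])
    (shape_nonneg hβ z) (fun i => le_rfl) hα (lt_sum_shape hαβ z)
  have hpos : ∀ s, 0 < s → 0 < shrinkInt η (fun i => b i + s) (shape β z) α := fun s hs =>
    shrinkInt_pos hη (fun i => add_pos (hb i) hs) (shape_nonneg hβ z) hα (lt_sum_shape hαβ z)
  have h1 := Real.log_le_log (hpos σ hσ.1) hup
  have h2 := Real.log_le_log (hpos T hT) hlow
  have h3 := abs_le.1 (h₀ z)
  have h4 := abs_le.1 (h₁ z)
  have h5 : 0 ≤ C₀ * 2 ^ ∑ i, z i := by positivity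
  have h6 : 0 ≤ C₁ * 2 ^ ∑ i, z i := by positivity
  rw [add_mul, logShrink, abs_le]
  constructor <;> linarith [h3.1, h3.2, h4.1, h4.2]

/-- Given a uniform `C`, this majorant is free of `c` and summable in `z`, which allows termwise
differentiation. The base `4` is `2 * 2`: one factor from the derivative of the Poisson weight, one
from the logarithm. -/
lemma abs_weightedLogDeriv_le (hη : 0 ≤ η) (hα : 0 < α) (hαβ : α ≤ ∑ i, β i - 1)
    (hb : ∀ i, 0 < b i) (hβ : ∀ i, 0 < β i) (hμ : ∀ i, 0 ≤ μ i) {c : Fin d → ℝ}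
    (hbc : ∀ i, b i ≤ c i) {C : ℝ} (z : Fin d → ℕ)
    (hC : |logShrink η α c β z| ≤ C * 2 ^ ∑ i, z i) :
    |weightedLogDeriv η α c β μ z| ≤ Real.exp (∑ i, (b i)⁻¹ * μ i) *
      (((∑ i, (b i)⁻¹ * ((b i)⁻¹ * μ i) + ∑ i, (b i)⁻¹) * C + (∑ i, (b i)⁻¹ + ∑ i, β i * (b i)⁻¹)) *
        (poissonLik b⁻¹ μ z * 4 ^ ∑ i, z i)) := by
  have hc : ∀ i, 0 < c i := fun i => (hb i).trans_le (hbc i)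
  have hbi : ∀ i, 0 < (b i)⁻¹ := fun i => inv_pos.2 (hb i)
  have hci : ∀ i, 0 < (c i)⁻¹ := fun i => inv_pos.2 (hc i)
  have hcb : ∀ i, (c i)⁻¹ ≤ (b i)⁻¹ := fun i => inv_anti₀ (hb i) (hbc i)
  set W : ℝ := 2 ^ ∑ i, z i with hW
  have hW1 : 1 ≤ W := one_le_pow₀ one_le_two
  have h4 : (4 : ℝ) ^ ∑ i, z i = W * W := by rw [hW, ← mul_pow]; norm_num
  have hz := sum_mul_le_mul_two_pow z (u := fun i => (b i)⁻¹) fun i => (hbi i).le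
  have h1 : |∑ i, (c i)⁻¹ * ((c i)⁻¹ * μ i - z i)| ≤
      (∑ i, (b i)⁻¹ * ((b i)⁻¹ * μ i) + ∑ i, (b i)⁻¹) * W := by
    have hA : 0 ≤ ∑ i, (b i)⁻¹ * ((b i)⁻¹ * μ i) :=
      Finset.sum_nonneg fun i _ => mul_nonneg (hbi i).le (mul_nonneg (hbi i).le (hμ i))
    calc |∑ i, (c i)⁻¹ * ((c i)⁻¹ * μ i - z i)|
        ≤ ∑ i, ((b i)⁻¹ * ((b i)⁻¹ * μ i) + z i * (b i)⁻¹) := by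
          refine (Finset.abs_sum_le_sum_abs _ _).trans (Finset.sum_le_sum fun i _ => ?_)
          rw [abs_mul, abs_of_pos (hci i), mul_comm (z i : ℝ), ← mul_add]
          refine mul_le_mul (hcb i) ?_ (abs_nonneg _) (hbi i).le
          have e1 := mul_le_mul_of_nonneg_right (hcb i) (hμ i)
          have e2 := mul_nonneg (hci i).le (hμ i)
          have e3 := Nat.cast_nonneg (α := ℝ) (z i)
          rw [abs_le]
          constructor <;> linarith
      _ ≤ _ := by
          rw [Finset.sum_add_distrib, add_mul]
          have := le_mul_of_one_le_right hA hW1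
          linarith
  have hSpos := shrinkInt_pos hη hc (shape_nonneg hβ z) hα (lt_sum_shape hαβ z)
  have h2 : |(∑ i, shape β z i * (c i)⁻¹ * (shrinkInt η c (shape β z + Pi.single i 1) α -
      shrinkInt η c (shape β z) α)) / shrinkInt η c (shape β z) α| ≤
      (∑ i, (b i)⁻¹ + ∑ i, β i * (b i)⁻¹) * W := by
    rw [abs_div, abs_of_pos hSpos, div_le_iff₀ hSpos]
    have hB : 0 ≤ ∑ i, β i * (b i)⁻¹ :=
      Finset.sum_nonneg fun i _ => mul_nonneg (hβ i).le (hbi i).le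
    calc |∑ i, shape β z i * (c i)⁻¹ * (shrinkInt η c (shape β z + Pi.single i 1) α -
        shrinkInt η c (shape β z) α)|
        ≤ ∑ i, (z i * (b i)⁻¹ + β i * (b i)⁻¹) * shrinkInt η c (shape β z) α := by
          refine (Finset.abs_sum_le_sum_abs _ _).trans (Finset.sum_le_sum fun i _ => ?_)
          have e1 := shape_nonneg hβ z i
          rw [abs_mul, abs_of_nonneg (mul_nonneg e1 (hci i).le), ← add_mul]
          exact mul_le_mul (mul_le_mul_of_nonneg_left (hcb i) e1)
            (abs_shrinkInt_ratio_le hη hα hαβ hc hβ z i) (abs_nonneg _)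
            (mul_nonneg e1 (hbi i).le)
      _ ≤ _ := by
          rw [← Finset.sum_mul, Finset.sum_add_distrib]
          refine mul_le_mul_of_nonneg_right ?_ hSpos.le
          have := le_mul_of_one_le_right hB hW1
          rw [add_mul]
          linarith
  have hC0 : 0 ≤ C * W := (abs_nonneg _).trans hC
  have hP := poissonLik_nonneg (t := c⁻¹) (lam := μ) (fun i => mul_nonneg (hci i).le (hμ i)) z
  have hPb := poissonLik_nonneg (t := b⁻¹) (lam := μ) (fun i => mul_nonneg (hbi i).le (hμ i)) z
  have hPle := poissonLik_shift_le hb hbc hμ z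
  have h3 := mul_le_mul h1 hC (abs_nonneg _) ((abs_nonneg _).trans h1)
  have hE : 0 ≤ (∑ i, (b i)⁻¹ + ∑ i, β i * (b i)⁻¹) * W := (abs_nonneg _).trans h2
  rw [weightedLogDeriv, abs_mul, abs_of_nonneg hP]
  refine (mul_le_mul hPle (abs_add_le _ _) (abs_nonneg _)
    (mul_nonneg (Real.exp_pos _).le hPb)).trans ?_
  rw [abs_mul]
  have h5 := le_mul_of_one_le_right hE hW1
  have h6 : |∑ i, (c i)⁻¹ * ((c i)⁻¹ * μ i - z i)| * |logShrink η α c β z| +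
      |(∑ i, shape β z i * (c i)⁻¹ * (shrinkInt η c (shape β z + Pi.single i 1) α -
      shrinkInt η c (shape β z) α)) / shrinkInt η c (shape β z) α| ≤
      ((∑ i, (b i)⁻¹ * ((b i)⁻¹ * μ i) + ∑ i, (b i)⁻¹) * C +
        (∑ i, (b i)⁻¹ + ∑ i, β i * (b i)⁻¹)) * (W * W) := by
    linarith
  refine (mul_le_mul_of_nonneg_left h6 (mul_nonneg (Real.exp_pos _).le hPb)).trans_eq ?_
  rw [h4]
  ring

end

/-! ### Sign of the drift and strict monotonicity. -/

section

variable {η α : ℝ} {b c β μ : Fin d → ℝ}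

lemma nonempty_of_lt_sum (hα : 0 < α) (hαβ : α ≤ ∑ i, β i - 1) : Nonempty (Fin d) := by
  by_contra h
  rw [not_nonempty_iff] at h
  rw [Finset.univ_eq_empty, Finset.sum_empty] at hαβ
  linarith

/-- The logarithm of `shrinkInt` at the parameter of `z` with its `i`-th coordinate decreased. -/
noncomputable def logShrinkPred (η α : ℝ) (c β : Fin d → ℝ) (i : Fin d) (z : Fin d → ℕ) : ℝ :=
  Real.log (shrinkInt η c (shape β z - Pi.single i 1) α)

lemma logShrinkPred_add_single (η α : ℝ) (c β : Fin d → ℝ) (i : Fin d) (z : Fin d → ℕ) :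
    logShrinkPred η α c β i (z + Pi.single i 1) = logShrink η α c β z := by
  rw [logShrinkPred, logShrink, shape_add_single, add_sub_cancel_right]

/-- The integrand of the expectation that gives the derivative of the expected `logShrink`. -/
noncomputable def logDrift (η α : ℝ) (c β : Fin d → ℝ) (z : Fin d → ℕ) : ℝ :=
  ∑ i, (c i)⁻¹ * (z i * (logShrinkPred η α c β i z - logShrink η α c β z) + shape β z i *
    ((shrinkInt η c (shape β z + Pi.single i 1) α - shrinkInt η c (shape β z) α) /
      shrinkInt η c (shape β z) α))

/-- By `log u ≤ u - 1` on the backward ratios, the drift is at most the superharmonic expression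
divided by the integral itself. -/
lemma logDrift_nonpos (hη : 0 ≤ η) (hα : 0 < α) (hαβ : α ≤ ∑ i, β i - 1) (hc : ∀ i, 0 < c i)
    (hβ : ∀ i, 0 < β i) {z : Fin d → ℕ} (hz : z ≠ 0) : logDrift η α c β z ≤ 0 := by
  have hpos : ∀ z, 0 < shrinkInt η c (shape β z) α := fun z =>
    shrinkInt_pos hη hc (shape_nonneg hβ z) hα (lt_sum_shape hαβ z)
  have h := div_nonpos_of_nonpos_of_nonneg (sum_shrinkInt_nonpos hη hc hβ hα hαβ hz) (hpos z).le
  refine le_trans ?_ h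
  rw [Finset.sum_div]
  refine Finset.sum_le_sum fun i _ => ?_
  rw [mul_div_assoc, add_div, mul_div_assoc, mul_div_assoc]
  refine mul_le_mul_of_nonneg_left (add_le_add_left ?_ _) (inv_pos.2 (hc i)).le
  rcases eq_or_ne (z i) 0 with h0 | h0
  · simp [h0]
  refine mul_le_mul_of_nonneg_left ?_ (Nat.cast_nonneg _)
  have hs : shape β z - Pi.single i 1 = shape β (z - Pi.single i 1) := by
    rw [sub_eq_iff_eq_add, ← shape_add_single, sub_single_add_single h0]
  rw [logShrinkPred, logShrink, hs, ← Real.log_div (hpos _).ne' (hpos _).ne', sub_div,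
    div_self (hpos z).ne']
  exact Real.log_le_sub_one_of_pos (div_pos (hpos _) (hpos _))

/-- At the origin only forward differences survive, and each is strictly negative. This settles the
point missed by the recurrence and supplies the strictness. -/
lemma logDrift_zero_neg (hη : 0 ≤ η) (hα : 0 < α) (hαβ : α ≤ ∑ i, β i - 1) (hc : ∀ i, 0 < c i)
    (hβ : ∀ i, 0 < β i) : logDrift η α c β 0 < 0 := by
  have := nonempty_of_lt_sum hα hαβ
  refine Finset.sum_neg (fun i _ => ?_) Finset.univ_nonempty
  have h1 := shrinkInt_sub_shrinkInt hη hc (shape_nonneg hβ 0) hα (lt_sum_shape hαβ 0) i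
  have h2 : 0 < shrinkInt η c (shape β 0 + Pi.single i 1) (α + 1) := by
    refine shrinkInt_pos hη hc (add_single_nonneg (shape_nonneg hβ 0) i) (by linarith) ?_
    have := lt_sum_shape hαβ 0
    rw [sum_add_single]
    linarith
  have h3 := mul_pos (hc i) h2
  refine mul_neg_of_pos_of_neg (inv_pos.2 (hc i)) ?_
  simp only [Pi.zero_apply, Nat.cast_zero, zero_mul, zero_add]
  exact mul_neg_of_pos_of_neg (shape_pos hβ 0 i) (div_neg_of_neg_of_pos (by linarith)
    (shrinkInt_pos hη hc (shape_nonneg hβ 0) hα (lt_sum_shape hαβ 0)))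

lemma poissonLik_zero_pos (t lam : Fin d → ℝ) : 0 < poissonLik t lam 0 :=
  Finset.prod_pos fun i _ => by simp [Real.exp_pos]

lemma tsum_weightedLogDeriv_neg (hη : 0 ≤ η) (hα : 0 < α) (hαβ : α ≤ ∑ i, β i - 1)
    (hc : ∀ i, 0 < c i) (hβ : ∀ i, 0 < β i) (hμ : ∀ i, 0 ≤ μ i) :
    ∑' z, weightedLogDeriv η α c β μ z < 0 := by
  have hm : ∀ i, 0 ≤ c⁻¹ i * μ i := fun i => mul_nonneg (inv_pos.2 (hc i)).le (hμ i)
  obtain ⟨C, hC0, hC⟩ := exists_abs_log_shrinkInt_le hη hc hβ hα hαβ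
  have hsum : Summable (weightedLogDeriv η α c β μ) :=
    Summable.of_norm_bounded (((summable_poissonLik_mul_pow hm (by norm_num : (0 : ℝ) ≤ 4)).mul_left
      _).mul_left _) fun z => abs_weightedLogDeriv_le hη hα hαβ hc hβ hμ (fun _ => le_rfl) z (hC z)
  have hL : Summable fun z => poissonLik c⁻¹ μ z * logShrink η α c β z :=
    summable_poissonLik_mul_of_le hm zero_le_two hC
  have hpred : ∀ i, Summable fun z => poissonLik c⁻¹ μ z * (z i * logShrinkPred η α c β i z) := by
    intro i
    refine summable_poissonLik_mul_of_le hm (by norm_num : (0 : ℝ) ≤ 4) (C := C) fun z => ?_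
    rcases eq_or_ne (z i) 0 with h0 | h0
    · simp only [h0, Nat.cast_zero, zero_mul, abs_zero]
      positivity
    have h1 : logShrinkPred η α c β i z = logShrink η α c β (z - Pi.single i 1) := by
      rw [← logShrinkPred_add_single, sub_single_add_single h0]
    have h2 := hC (z - Pi.single i 1)
    have h3 : ∑ j, (z - Pi.single i 1 : Fin d → ℕ) j ≤ ∑ j, z j :=
      Finset.sum_le_sum fun j _ => Nat.sub_le _ _
    have h4 : (z i : ℝ) ≤ 2 ^ ∑ j, z j := by
      have h1 : z i ≤ ∑ i, z i :=
        Finset.single_le_sum (fun _ _ => Nat.zero_le _) (Finset.mem_univ i)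
      exact_mod_cast h1.trans Nat.lt_two_pow_self.le
    have h5 : (2 : ℝ) ^ ∑ j, (z - Pi.single i 1 : Fin d → ℕ) j ≤ 2 ^ ∑ j, z j :=
      pow_le_pow_right₀ one_le_two h3
    have h6 : (4 : ℝ) ^ ∑ j, z j = 2 ^ (∑ j, z j) * 2 ^ ∑ j, z j := by
      rw [← mul_pow]; norm_num
    rw [abs_mul, Nat.abs_cast, h1, h6]
    calc (z i : ℝ) * |logShrink η α c β (z - Pi.single i 1)|
        ≤ 2 ^ (∑ j, z j) * (C * 2 ^ ∑ j, z j) :=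
          mul_le_mul h4 (h2.trans (mul_le_mul_of_nonneg_left h5 hC0)) (abs_nonneg _) (by positivity)
      _ = _ := by ring
  -- A series of sum zero, by the Poisson identity. Adding it replaces `(μ i / c i) * logShrink` by
  -- `z i` times the logarithm at the predecessor, turning the derivative into the drift.
  have hdiff : ∀ i, HasSum (fun z => (c i)⁻¹ * (poissonLik c⁻¹ μ z *
      (z i * logShrinkPred η α c β i z) - c⁻¹ i * μ i *
        (poissonLik c⁻¹ μ z * logShrink η α c β z))) 0 := by
    intro i
    have h1 := (hpred i).hasSum
    rw [tsum_poissonLik_mul_coord] at h1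
    simp_rw [logShrinkPred_add_single] at h1
    simpa using (h1.sub (hL.hasSum.mul_left (c⁻¹ i * μ i))).mul_left (c i)⁻¹
  have htot := hsum.hasSum.add (hasSum_sum fun i (_ : i ∈ Finset.univ) => hdiff i)
  have hpt : ∀ z, weightedLogDeriv η α c β μ z + ∑ i, (c i)⁻¹ * (poissonLik c⁻¹ μ z *
      (z i * logShrinkPred η α c β i z) - c⁻¹ i * μ i *
        (poissonLik c⁻¹ μ z * logShrink η α c β z)) =
      poissonLik c⁻¹ μ z * logDrift η α c β z := by
    intro z
    rw [weightedLogDeriv, logDrift, Finset.sum_mul, Finset.sum_div, ← Finset.sum_add_distrib,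
      Finset.mul_sum, Finset.mul_sum, ← Finset.sum_add_distrib]
    refine Finset.sum_congr rfl fun i _ => ?_
    simp only [Pi.inv_apply]
    ring
  simp_rw [hpt] at htot
  rw [Finset.sum_const_zero, add_zero] at htot
  have hle : ∀ z, poissonLik c⁻¹ μ z * logDrift η α c β z ≤ 0 := fun z => by
    refine mul_nonpos_of_nonneg_of_nonpos (poissonLik_nonneg hm z) ?_
    rcases eq_or_ne z 0 with rfl | hz
    · exact (logDrift_zero_neg hη hα hαβ hc hβ).le
    · exact logDrift_nonpos hη hα hαβ hc hβ hz
  have := htot.summable.tsum_lt_tsum (i := 0) hle (mul_neg_of_pos_of_neg (poissonLik_zero_pos _ _)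
    (logDrift_zero_neg hη hα hαβ hc hβ)) summable_zero
  rwa [htot.tsum_eq, tsum_zero] at this

/-- The Poisson expectation of `logShrink`, with the means `μ i / c i`, strictly decreases when a
common constant is added to all `c i`. -/
theorem tsum_poissonLik_logShrink_lt (hη : 0 ≤ η) (hα : 0 < α) (hαβ : α ≤ ∑ i, β i - 1)
    (hc : ∀ i, 0 < c i) (hβ : ∀ i, 0 < β i) (hμ : ∀ i, 0 ≤ μ i) {δ : ℝ} (hδ : 0 < δ) :
    ∑' z, poissonLik (fun i => c i + δ)⁻¹ μ z * logShrink η α (fun i => c i + δ) β z <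
      ∑' z, poissonLik c⁻¹ μ z * logShrink η α c β z := by
  have := nonempty_of_lt_sum hα hαβ
  -- Starting from `b = c - ε` makes `c` the interior point `σ = ε`; the extra `1` in `T` leaves
  -- room beyond `ε + δ`.
  obtain ⟨ε, hε, hεc⟩ : ∃ ε > 0, ∀ i, ε < c i := by
    obtain ⟨j, hj⟩ := Finite.exists_min c
    exact ⟨c j / 2, half_pos (hc j), fun i => (half_lt_self (hc j)).trans_le (hj i)⟩
  set b : Fin d → ℝ := fun i => c i - ε with hb
  have hbpos : ∀ i, 0 < b i := fun i => sub_pos.2 (hεc i)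
  set T : ℝ := ε + δ + 1 with hT
  obtain ⟨C, hC0, hC⟩ := exists_abs_logShrink_le (T := T) hη hα hαβ hbpos hβ (by linarith)
  have hm : ∀ i, 0 ≤ b⁻¹ i * μ i := fun i => mul_nonneg (inv_pos.2 (hbpos i)).le (hμ i)
  have hεT : ε ∈ Ioo 0 T := ⟨hε, by linarith⟩
  have hderiv : ∀ σ ∈ Ioo 0 T, HasDerivAt (fun σ => ∑' z, poissonLik (fun i => b i + σ)⁻¹ μ z *
      logShrink η α (fun i => b i + σ) β z)
      (∑' z, weightedLogDeriv η α (fun i => b i + σ) β μ z) σ := by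
    intro σ hσ
    refine hasDerivAt_tsum_of_isPreconnected
      (((summable_poissonLik_mul_pow hm (by norm_num : (0 : ℝ) ≤ 4)).mul_left
      _).mul_left _) isOpen_Ioo isPreconnected_Ioo
      (fun z s hs => hasDerivAt_weighted_logShrink hη hα hαβ hbpos hβ z hs.1)
      (fun z s hs => abs_weightedLogDeriv_le hη hα hαβ hbpos hβ hμ
        (c := fun i => b i + s) (fun i => by linarith [hs.1]) z (hC s hs z)) hεT ?_ hσ
    refine summable_poissonLik_mul_of_le (fun i => ?_) zero_le_two (hC ε hεT)
    exact mul_nonneg (inv_pos.2 (add_pos (hbpos i) hε)).le (hμ i)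
  have hanti := strictAntiOn_of_deriv_neg (convex_Icc ε (ε + δ))
    (f := fun σ => ∑' z, poissonLik (fun i => b i + σ)⁻¹ μ z *
      logShrink η α (fun i => b i + σ) β z)
    (fun σ hσ => (hderiv σ ⟨hε.trans_le hσ.1, by linarith [hσ.2]⟩).continuousAt.continuousWithinAt)
    (fun σ hσ => by
      rw [interior_Icc] at hσ
      have hσ0 : 0 < σ := hε.trans hσ.1
      rw [(hderiv σ ⟨hσ0, by linarith [hσ.2]⟩).deriv]
      exact tsum_weightedLogDeriv_neg hη hα hαβ (fun i => add_pos (hbpos i) hσ0) hβ hμ)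
  have h := hanti (left_mem_Icc.2 (by linarith)) (right_mem_Icc.2 (by linarith))
    (show ε < ε + δ by linarith)
  have h1 : (fun i => b i + ε) = c := by funext i; simp [hb]
  have h2 : (fun i => b i + (ε + δ)) = fun i => c i + δ := by funext i; simp [hb]; ring
  simpa only [h1, h2] using h

end

/-! ### Gamma integrals and the Laplace representation. -/

/-- The product of unnormalized Gamma densities with shapes `a i` and rates `t i`. -/
noncomputable def gammaWeight (t a lam : Fin d → ℝ) : ℝ :=
  ∏ i, lam i ^ (a i - 1) * Real.exp (-(t i * lam i))

/-- The normalizing constant of `gammaWeight`. -/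
noncomputable def gammaNorm (t a : Fin d → ℝ) : ℝ := ∏ i, (1 / t i) ^ a i * Real.Gamma (a i)

lemma posOrthant_eq_pi (d : ℕ) : posOrthant d = Set.univ.pi fun _ => Ioi (0 : ℝ) := by
  ext; simp [posOrthant]

lemma measurableSet_posOrthant (d : ℕ) : MeasurableSet (posOrthant d) := by
  rw [posOrthant_eq_pi]
  exact MeasurableSet.univ_pi fun _ => measurableSet_Ioi

lemma volume_restrict_posOrthant (d : ℕ) :
    (volume : Measure (Fin d → ℝ)).restrict (posOrthant d) =
      Measure.pi fun _ => (volume : Measure ℝ).restrict (Ioi 0) := by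
  rw [posOrthant_eq_pi, volume_pi, Measure.restrict_pi_pi]

lemma gammaNorm_pos {t a : Fin d → ℝ} (ht : ∀ i, 0 < t i) (ha : ∀ i, 0 < a i) :
    0 < gammaNorm t a :=
  Finset.prod_pos fun i _ => mul_pos (Real.rpow_pos_of_pos (one_div_pos.2 (ht i)) _)
    (Real.Gamma_pos_of_pos (ha i))

lemma gammaWeight_pos (t a : Fin d → ℝ) {lam : Fin d → ℝ} (hlam : lam ∈ posOrthant d) :
    0 < gammaWeight t a lam :=
  Finset.prod_pos fun i _ => mul_pos (Real.rpow_pos_of_pos (hlam i) _) (Real.exp_pos _)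

lemma integrableOn_gammaWeight {t a : Fin d → ℝ} (ht : ∀ i, 0 < t i) (ha : ∀ i, 0 < a i) :
    IntegrableOn (gammaWeight t a) (posOrthant d) := by
  rw [IntegrableOn, volume_restrict_posOrthant]
  refine Integrable.fintype_prod (f := fun i (u : ℝ) => u ^ (a i - 1) * Real.exp (-(t i * u)))
    fun i => ?_
  have := integrableOn_rpow_mul_exp_neg_mul_rpow (p := 1) (s := a i - 1) (b := t i)
    (by linarith [ha i]) one_pos (ht i)
  simpa [Real.rpow_one, IntegrableOn] using this

lemma integral_gammaWeight {t a : Fin d → ℝ} (ht : ∀ i, 0 < t i) (ha : ∀ i, 0 < a i) :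
    ∫ lam in posOrthant d, gammaWeight t a lam = gammaNorm t a := by
  rw [volume_restrict_posOrthant]
  refine (integral_fintype_prod_eq_prod
    (fun i (u : ℝ) => u ^ (a i - 1) * Real.exp (-(t i * u)))).trans ?_
  exact Finset.prod_congr rfl fun i _ => Real.integral_rpow_mul_exp_neg_mul_Ioi (ha i) (ht i)

section

variable {t a w : Fin d → ℝ} {η α : ℝ}

/-- The joint integrand behind the Laplace representation
`S ^ (-α) = Γ(α)⁻¹ ∫₀^∞ v ^ (α - 1) e ^ (-v S) dv`. -/
noncomputable def gammaLaplace (η α : ℝ) (t a w : Fin d → ℝ) (q : (Fin d → ℝ) × ℝ) : ℝ :=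
  gammaWeight t a q.1 * (q.2 ^ (α - 1) * Real.exp (-((∑ i, w i * q.1 i + η) * q.2)))

/-- For fixed `v` the Laplace factor only tilts the Gamma rates from `t i` to `t i + w i * v`. -/
lemma gammaLaplace_eq (η α : ℝ) (t a w lam : Fin d → ℝ) (v : ℝ) :
    gammaLaplace η α t a w (lam, v) =
      v ^ (α - 1) * Real.exp (-(η * v)) * gammaWeight (fun i => t i + w i * v) a lam := by
  have h : gammaWeight (fun i => t i + w i * v) a lam =
      gammaWeight t a lam * Real.exp (-∑ i, w i * lam i * v) := by
    rw [← Finset.sum_neg_distrib, Real.exp_sum, gammaWeight, gammaWeight, ← Finset.prod_mul_distrib]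
    refine Finset.prod_congr rfl fun i _ => ?_
    rw [mul_assoc, ← Real.exp_add]
    ring_nf
  have h2 : Real.exp (-((∑ i, w i * lam i + η) * v)) =
      Real.exp (-(η * v)) * Real.exp (-∑ i, w i * lam i * v) := by
    rw [← Real.exp_add, ← Finset.sum_mul]
    ring_nf
  rw [gammaLaplace, h, h2]
  ring

lemma integral_gammaLaplace_left (η α : ℝ) (ht : ∀ i, 0 < t i) (ha : ∀ i, 0 < a i)
    (hw : ∀ i, 0 < w i) {v : ℝ} (hv : 0 < v) :
    ∫ lam in posOrthant d, gammaLaplace η α t a w (lam, v) =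
      gammaNorm t a * shrinkKernel η (fun i => w i / t i) a α v := by
  have htv : ∀ i, 0 < t i + w i * v := fun i => add_pos (ht i) (mul_pos (hw i) hv)
  simp_rw [gammaLaplace_eq]
  rw [integral_const_mul, integral_gammaWeight htv ha, shrinkKernel]
  have h : gammaNorm (fun i => t i + w i * v) a =
      gammaNorm t a * Real.exp (-∑ i, a i * Real.log (1 + w i / t i * v)) := by
    rw [← Finset.sum_neg_distrib, Real.exp_sum, gammaNorm, gammaNorm, ← Finset.prod_mul_distrib]
    refine Finset.prod_congr rfl fun i _ => ?_
    have h1 : 0 < 1 + w i / t i * v := by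
      have := mul_pos (div_pos (hw i) (ht i)) hv
      linarith
    have h2 : Real.exp (-(a i * Real.log (1 + w i / t i * v))) = (1 / (1 + w i / t i * v)) ^ a i := by
      rw [Real.rpow_def_of_pos (one_div_pos.2 h1), one_div, Real.log_inv]
      ring_nf
    have h3 : 1 / (t i + w i * v) = 1 / t i * (1 / (1 + w i / t i * v)) := by
      have := (ht i).ne'
      have := htv i
      field_simp
    rw [h2, h3, Real.mul_rpow (one_div_pos.2 (ht i)).le (one_div_pos.2 h1).le]
    ring
  rw [h, neg_add, Real.exp_add]
  ring

lemma integral_gammaLaplace_right (hα : 0 < α) {lam : Fin d → ℝ}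
    (h : 0 < ∑ i, w i * lam i + η) :
    ∫ v in Ioi (0 : ℝ), gammaLaplace η α t a w (lam, v) =
      Real.Gamma α * (gammaWeight t a lam * (∑ i, w i * lam i + η) ^ (-α)) := by
  simp only [gammaLaplace]
  rw [integral_const_mul, Real.integral_rpow_mul_exp_neg_mul_Ioi hα h, one_div,
    Real.inv_rpow h.le, Real.rpow_neg h.le]
  ring

lemma measurable_gammaLaplace (η α : ℝ) (t a w : Fin d → ℝ) :
    Measurable (gammaLaplace η α t a w) := by
  unfold gammaLaplace gammaWeight
  fun_prop

/-- By Tonelli: the integrand is nonnegative, and its `lam`-integral is a multiple of the integrable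
`shrinkKernel`. -/
lemma integrable_gammaLaplace (hη : 0 ≤ η) (hα : 0 < α) (ht : ∀ i, 0 < t i) (ha : ∀ i, 0 < a i)
    (hw : ∀ i, 0 < w i) (hαa : α < ∑ i, a i) :
    Integrable (gammaLaplace η α t a w)
      (((volume : Measure (Fin d → ℝ)).restrict (posOrthant d)).prod
        ((volume : Measure ℝ).restrict (Ioi 0))) := by
  have hc : ∀ i, 0 < w i / t i := fun i => div_pos (hw i) (ht i)
  rw [integrable_prod_iff' (measurable_gammaLaplace ..).aestronglyMeasurable]
  constructor
  · refine (ae_restrict_mem measurableSet_Ioi).mono fun v hv => ?_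
    simp_rw [gammaLaplace_eq]
    exact (integrableOn_gammaWeight (fun i => add_pos (ht i) (mul_pos (hw i) hv)) ha).const_mul _
  · refine ((integrableOn_shrinkKernel hη hc (fun i => (ha i).le) hα hαa).const_mul
      (gammaNorm t a)).congr ?_
    refine (ae_restrict_mem measurableSet_Ioi).mono fun v hv => ?_
    dsimp only
    rw [← integral_gammaLaplace_left η α ht ha hw hv]
    refine setIntegral_congr_fun (measurableSet_posOrthant d) fun lam hlam => ?_
    have hv : 0 < v := hv
    rw [gammaLaplace_eq, Real.norm_of_nonneg]
    have := gammaWeight_pos (fun i => t i + w i * v) a hlam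
    positivity

lemma sum_add_pos [Nonempty (Fin d)] (hη : 0 ≤ η) (hw : ∀ i, 0 < w i) {lam : Fin d → ℝ}
    (hlam : lam ∈ posOrthant d) : 0 < ∑ i, w i * lam i + η :=
  add_pos_of_pos_of_nonneg (Finset.sum_pos (fun i _ => mul_pos (hw i) (hlam i))
    Finset.univ_nonempty) hη

lemma integrableOn_gammaWeight_mul_rpow [Nonempty (Fin d)] (hη : 0 ≤ η) (hα : 0 < α)
    (ht : ∀ i, 0 < t i) (ha : ∀ i, 0 < a i) (hw : ∀ i, 0 < w i) (hαa : α < ∑ i, a i) :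
    IntegrableOn (fun lam => gammaWeight t a lam * (∑ i, w i * lam i + η) ^ (-α))
      (posOrthant d) := by
  have h := ((integrable_gammaLaplace hη hα ht ha hw hαa).integral_prod_left).const_mul
    (Real.Gamma α)⁻¹
  refine h.congr ((ae_restrict_mem (measurableSet_posOrthant d)).mono fun lam hlam => ?_)
  dsimp only
  rw [integral_gammaLaplace_right hα (sum_add_pos hη hw hlam),
    inv_mul_cancel_left₀ (Real.Gamma_pos_of_pos hα).ne']

lemma integral_gammaWeight_mul_rpow [Nonempty (Fin d)] (hη : 0 ≤ η) (hα : 0 < α)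
    (ht : ∀ i, 0 < t i) (ha : ∀ i, 0 < a i) (hw : ∀ i, 0 < w i) (hαa : α < ∑ i, a i) :
    ∫ lam in posOrthant d, gammaWeight t a lam * (∑ i, w i * lam i + η) ^ (-α) =
      gammaNorm t a * (shrinkInt η (fun i => w i / t i) a α / Real.Gamma α) := by
  have h1 := integral_integral_swap (f := fun lam v => gammaLaplace η α t a w (lam, v))
    (integrable_gammaLaplace hη hα ht ha hw hαa)
  have h2 : ∫ lam in posOrthant d, ∫ v in Ioi (0 : ℝ), gammaLaplace η α t a w (lam, v) =
      Real.Gamma α *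
        ∫ lam in posOrthant d, gammaWeight t a lam * (∑ i, w i * lam i + η) ^ (-α) := by
    rw [← integral_const_mul]
    exact setIntegral_congr_fun (measurableSet_posOrthant d) fun lam hlam =>
      integral_gammaLaplace_right hα (sum_add_pos hη hw hlam)
  have h3 : ∫ v in Ioi (0 : ℝ), ∫ lam in posOrthant d, gammaLaplace η α t a w (lam, v) =
      gammaNorm t a * shrinkInt η (fun i => w i / t i) a α := by
    rw [shrinkInt, ← integral_const_mul]
    exact setIntegral_congr_fun measurableSet_Ioi fun v hv =>
      integral_gammaLaplace_left η α ht ha hw hv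
  rw [h2, h3] at h1
  have := (Real.Gamma_pos_of_pos hα).ne'
  field_simp
  linarith

end

/-! ### Closed forms of the predictive distributions. -/

/-- The factor of the Poisson likelihood that depends on the observation but not on the
intensities. -/
noncomputable def likCoef (t : Fin d → ℝ) (z : Fin d → ℕ) : ℝ := ∏ i, t i ^ z i / ((z i)! : ℝ)

lemma likCoef_pos {t : Fin d → ℝ} (ht : ∀ i, 0 < t i) (z : Fin d → ℕ) : 0 < likCoef t z :=
  Finset.prod_pos fun i _ => by have := ht i; positivity

lemma poissonLik_mul_priorBeta (t β : Fin d → ℝ) (z : Fin d → ℕ) {lam : Fin d → ℝ}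
    (hlam : lam ∈ posOrthant d) :
    poissonLik t lam z * priorBeta β lam = likCoef t z * gammaWeight t (shape β z) lam := by
  simp only [poissonLik, priorBeta, likCoef, gammaWeight, ← Finset.prod_mul_distrib]
  refine Finset.prod_congr rfl fun i _ => ?_
  rw [shape, add_sub_assoc, Real.rpow_add (hlam i), Real.rpow_natCast, mul_pow]
  ring

lemma poissonLik_mul_poissonLik_mul_priorBeta (r s β : Fin d → ℝ) (x y : Fin d → ℕ)
    {lam : Fin d → ℝ} (hlam : lam ∈ posOrthant d) :
    poissonLik r lam x * poissonLik s lam y * priorBeta β lam =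
      likCoef r x * likCoef s y * gammaWeight (r + s) (shape β (x + y)) lam := by
  rw [mul_assoc, poissonLik_mul_priorBeta _ _ _ hlam]
  simp only [poissonLik, likCoef, gammaWeight, ← Finset.prod_mul_distrib]
  refine Finset.prod_congr rfl fun i _ => ?_
  simp only [shape, Pi.add_apply, Nat.cast_add]
  rw [add_sub_assoc, add_sub_assoc, add_assoc, Real.rpow_add (hlam i), Real.rpow_add (hlam i),
    Real.rpow_add (hlam i), Real.rpow_natCast, Real.rpow_natCast, mul_pow, add_mul, neg_add,
    Real.exp_add]
  ring

section

variable {r s β : Fin d → ℝ}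

lemma marginal_priorBeta (hr : ∀ i, 0 < r i) (hβ : ∀ i, 0 < β i) (x : Fin d → ℕ) :
    marginal r (priorBeta β) x = likCoef r x * gammaNorm r (shape β x) := by
  rw [marginal, setIntegral_congr_fun (measurableSet_posOrthant d) fun lam hlam =>
    poissonLik_mul_priorBeta r β x hlam, integral_const_mul,
    integral_gammaWeight hr (shape_pos hβ x)]

lemma posteriorExists_priorBeta (hr : ∀ i, 0 < r i) (hβ : ∀ i, 0 < β i) :
    PosteriorExists r (priorBeta β) := fun x => by
  refine ⟨?_, ?_⟩
  · exact IntegrableOn.congr_fun ((integrableOn_gammaWeight hr (shape_pos hβ x)).const_mul _)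
      (fun lam hlam => (poissonLik_mul_priorBeta r β x hlam).symm) (measurableSet_posOrthant d)
  · rw [marginal_priorBeta hr hβ]
    exact mul_pos (likCoef_pos hr x) (gammaNorm_pos hr (shape_pos hβ x))

lemma predictive_priorBeta (hr : ∀ i, 0 < r i) (hs : ∀ i, 0 < s i) (hβ : ∀ i, 0 < β i)
    (x y : Fin d → ℕ) :
    predictive r s (priorBeta β) x y =
      likCoef s y * gammaNorm (r + s) (shape β (x + y)) / gammaNorm r (shape β x) := by
  have hrs : ∀ i, 0 < (r + s) i := fun i => add_pos (hr i) (hs i)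
  rw [predictive, marginal_priorBeta hr hβ, setIntegral_congr_fun (measurableSet_posOrthant d)
    fun lam hlam => poissonLik_mul_poissonLik_mul_priorBeta r s β x y hlam, integral_const_mul,
    integral_gammaWeight hrs (shape_pos hβ _), mul_assoc,
    mul_div_mul_left _ _ (likCoef_pos hr x).ne']

variable {w : Fin d → ℝ} {η α : ℝ} {θ : (Fin d → ℝ) → Fin d → ℝ}

/-- Only `θ_i ^ 2 = w_i λ_i` matters about the reparametrization, so one argument serves both cases.
-/
lemma mul_priorF_eq (hθ : ∀ lam ∈ posOrthant d, ∀ i, θ lam i ^ 2 = w i * lam i) {lam : Fin d → ℝ}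
    (hlam : lam ∈ posOrthant d) (u : ℝ) :
    u * priorF (shiftPoint η α) θ β lam =
      u * priorBeta β lam * (∑ i, w i * lam i + η) ^ (-α) := by
  simp only [priorF, shiftPoint, hθ lam hlam]
  ring

lemma marginal_priorF (hr : ∀ i, 0 < r i) (hβ : ∀ i, 0 < β i) (hη : 0 ≤ η) (hα : 0 < α)
    (hαβ : α ≤ ∑ i, β i - 1) (hw : ∀ i, 0 < w i)
    (hθ : ∀ lam ∈ posOrthant d, ∀ i, θ lam i ^ 2 = w i * lam i) (x : Fin d → ℕ) :
    IntegrableOn (fun lam => poissonLik r lam x * priorF (shiftPoint η α) θ β lam)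
      (posOrthant d) ∧
    marginal r (priorF (shiftPoint η α) θ β) x = likCoef r x * (gammaNorm r (shape β x) *
      (shrinkInt η (fun i => w i / r i) (shape β x) α / Real.Gamma α)) := by
  have := nonempty_of_lt_sum hα hαβ
  have h : ∀ lam ∈ posOrthant d, poissonLik r lam x * priorF (shiftPoint η α) θ β lam =
      likCoef r x * (gammaWeight r (shape β x) lam * (∑ i, w i * lam i + η) ^ (-α)) :=
    fun lam hlam => by
      rw [mul_priorF_eq hθ hlam, poissonLik_mul_priorBeta r β x hlam, mul_assoc]
  refine ⟨?_, ?_⟩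
  · exact IntegrableOn.congr_fun ((integrableOn_gammaWeight_mul_rpow hη hα hr (shape_pos hβ x) hw
      (lt_sum_shape hαβ x)).const_mul _) (fun lam hlam => (h lam hlam).symm)
      (measurableSet_posOrthant d)
  · rw [marginal, setIntegral_congr_fun (measurableSet_posOrthant d) h, integral_const_mul,
      integral_gammaWeight_mul_rpow hη hα hr (shape_pos hβ x) hw (lt_sum_shape hαβ x)]

lemma posteriorExists_priorF (hr : ∀ i, 0 < r i) (hβ : ∀ i, 0 < β i) (hη : 0 ≤ η) (hα : 0 < α)
    (hαβ : α ≤ ∑ i, β i - 1) (hw : ∀ i, 0 < w i)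
    (hθ : ∀ lam ∈ posOrthant d, ∀ i, θ lam i ^ 2 = w i * lam i) :
    PosteriorExists r (priorF (shiftPoint η α) θ β) := fun x => by
  obtain ⟨h1, h2⟩ := marginal_priorF hr hβ hη hα hαβ hw hθ x
  refine ⟨h1, ?_⟩
  rw [h2]
  exact mul_pos (likCoef_pos hr x) (mul_pos (gammaNorm_pos hr (shape_pos hβ x))
    (div_pos (shrinkInt_pos hη (fun i => div_pos (hw i) (hr i)) (shape_nonneg hβ x) hα
      (lt_sum_shape hαβ x)) (Real.Gamma_pos_of_pos hα)))

lemma predictive_priorF (hr : ∀ i, 0 < r i) (hs : ∀ i, 0 < s i) (hβ : ∀ i, 0 < β i) (hη : 0 ≤ η)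
    (hα : 0 < α) (hαβ : α ≤ ∑ i, β i - 1) (hw : ∀ i, 0 < w i)
    (hθ : ∀ lam ∈ posOrthant d, ∀ i, θ lam i ^ 2 = w i * lam i) (x y : Fin d → ℕ) :
    predictive r s (priorF (shiftPoint η α) θ β) x y = predictive r s (priorBeta β) x y *
      (shrinkInt η (fun i => w i / (r i + s i)) (shape β (x + y)) α /
        shrinkInt η (fun i => w i / r i) (shape β x) α) := by
  have := nonempty_of_lt_sum hα hαβ
  have hrs : ∀ i, 0 < (r + s) i := fun i => add_pos (hr i) (hs i)
  have h : ∀ lam ∈ posOrthant d,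
      poissonLik r lam x * poissonLik s lam y * priorF (shiftPoint η α) θ β lam =
      likCoef r x * likCoef s y * (gammaWeight (r + s) (shape β (x + y)) lam *
        (∑ i, w i * lam i + η) ^ (-α)) :=
    fun lam hlam => by
      rw [mul_priorF_eq hθ hlam, poissonLik_mul_poissonLik_mul_priorBeta r s β x y hlam, mul_assoc]
  rw [predictive_priorBeta hr hs hβ, predictive,
    (marginal_priorF hr hβ hη hα hαβ hw hθ x).2,
    setIntegral_congr_fun (measurableSet_posOrthant d) h, integral_const_mul,
    integral_gammaWeight_mul_rpow hη hα hrs (shape_pos hβ _) hw (lt_sum_shape hαβ _)]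
  have h1 := (likCoef_pos hr x).ne'
  have h2 := (Real.Gamma_pos_of_pos hα).ne'
  have h3 := (gammaNorm_pos hr (shape_pos hβ x)).ne'
  have h4 := (shrinkInt_pos hη (fun i => div_pos (hw i) (hr i)) (shape_nonneg hβ x) hα
    (lt_sum_shape hαβ x)).ne'
  simp only [Pi.add_apply]
  field_simp

end

/-! ### Growth of the log-likelihood ratio and finiteness of the risks. -/

/-- Induction on `Γ(u + 1) = u Γ(u)`: each step adds at most `A * 2 ^ n`, so the bound doubles. -/
lemma exists_abs_log_Gamma_le {b : ℝ} (hb : 0 < b) :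
    ∃ A, 0 ≤ A ∧ ∀ n : ℕ, |Real.log (Real.Gamma (n + b))| ≤ A * 2 ^ n := by
  set A := |Real.log (Real.Gamma b)| + |Real.log b| + b + 1 with hA
  have h1 := abs_nonneg (Real.log (Real.Gamma b))
  have h2 := abs_nonneg (Real.log b)
  refine ⟨A, by positivity, fun n => ?_⟩
  induction n with
  | zero => simp only [Nat.cast_zero, zero_add, pow_zero, mul_one]; linarith
  | succ n ih =>
    have hn : (0 : ℝ) ≤ n := Nat.cast_nonneg n
    have hnb : 0 < (n : ℝ) + b := by positivity
    have h3 : |Real.log (n + b)| ≤ A * 2 ^ n := by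
      have e1 : (n : ℝ) + 1 ≤ 2 ^ n := by exact_mod_cast Nat.lt_two_pow_self
      have e2 : (1 : ℝ) ≤ 2 ^ n := one_le_pow₀ one_le_two
      have e3 := Real.log_le_log hb (show b ≤ n + b by linarith)
      have e4 := (Real.log_le_sub_one_of_pos hnb)
      have e5 : A ≤ A * 2 ^ n := le_mul_of_one_le_right (by positivity) e2
      have e6 : (n : ℝ) + b ≤ A * 2 ^ n := by
        have e7 := mul_le_mul_of_nonneg_left e2 hb.le
        have e8 : (b + 1) * 2 ^ n ≤ A * 2 ^ n := by gcongr; linarith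
        linarith
      rw [abs_le]
      constructor <;> linarith [neg_abs_le (Real.log b)]
    have h4 : ((n + 1 : ℕ) : ℝ) + b = (n + b) + 1 := by push_cast; ring
    rw [h4, Real.Gamma_add_one hnb.ne', Real.log_mul hnb.ne' (Real.Gamma_pos_of_pos hnb).ne']
    refine (abs_add_le _ _).trans ?_
    rw [pow_succ]
    linarith

lemma exists_abs_log_gammaNorm_le {t β : Fin d → ℝ} (ht : ∀ i, 0 < t i) (hβ : ∀ i, 0 < β i) :
    ∃ C, 0 ≤ C ∧ ∀ z, |Real.log (gammaNorm t (shape β z))| ≤ C * 2 ^ ∑ i, z i := by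
  choose A hA0 hA using fun i => exists_abs_log_Gamma_le (hβ i)
  refine ⟨∑ i, ((1 + β i) * |Real.log (1 / t i)| + A i), Finset.sum_nonneg fun i _ =>
    add_nonneg (mul_nonneg (by linarith [hβ i]) (abs_nonneg _)) (hA0 i), fun z => ?_⟩
  have hpos : ∀ i, 0 < (1 / t i) ^ shape β z i := fun i =>
    Real.rpow_pos_of_pos (one_div_pos.2 (ht i)) _
  have hG : ∀ i, 0 < Real.Gamma (shape β z i) := fun i => Real.Gamma_pos_of_pos (shape_pos hβ z i)
  rw [gammaNorm, Real.log_prod fun i _ => (mul_pos (hpos i) (hG i)).ne', Finset.sum_mul]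
  refine (Finset.abs_sum_le_sum_abs _ _).trans (Finset.sum_le_sum fun i _ => ?_)
  have h1 : z i ≤ ∑ i, z i := Finset.single_le_sum (fun _ _ => Nat.zero_le _) (Finset.mem_univ i)
  have h2 : (2 : ℝ) ^ z i ≤ 2 ^ ∑ i, z i := pow_le_pow_right₀ one_le_two h1
  have h3 : (z i : ℝ) ≤ 2 ^ ∑ i, z i := by exact_mod_cast h1.trans Nat.lt_two_pow_self.le
  have h4 : (1 : ℝ) ≤ 2 ^ ∑ i, z i := one_le_pow₀ one_le_two
  rw [Real.log_mul (hpos i).ne' (hG i).ne', Real.log_rpow (one_div_pos.2 (ht i)), add_mul]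
  refine (abs_add_le _ _).trans (add_le_add ?_ ((hA i (z i)).trans
    (mul_le_mul_of_nonneg_left h2 (hA0 i))))
  rw [abs_mul, abs_of_pos (shape_pos hβ z i), mul_right_comm]
  refine mul_le_mul_of_nonneg_right ?_ (abs_nonneg _)
  have h5 := mul_le_mul_of_nonneg_left h4 (hβ i).le
  rw [shape, add_mul]
  linarith

lemma poissonLik_eq_likCoef_mul (t lam : Fin d → ℝ) (z : Fin d → ℕ) :
    poissonLik t lam z = likCoef t z * ∏ i, lam i ^ z i * Real.exp (-(t i * lam i)) := by
  rw [likCoef, ← Finset.prod_mul_distrib, poissonLik]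
  refine Finset.prod_congr rfl fun i _ => ?_
  rw [mul_pow]
  ring

lemma abs_log_prod_le {s lam : Fin d → ℝ} {y : Fin d → ℕ}
    (h : ∏ i, lam i ^ y i * Real.exp (-(s i * lam i)) ≠ 0) :
    |Real.log (∏ i, lam i ^ y i * Real.exp (-(s i * lam i)))| ≤
      (∑ i, |Real.log (lam i)| + ∑ i, |s i * lam i|) * 2 ^ ∑ i, y i := by
  have h0 := Finset.prod_ne_zero_iff.1 h
  rw [Real.log_prod h0]
  have h1 : ∀ i, Real.log (lam i ^ y i * Real.exp (-(s i * lam i))) =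
      y i * Real.log (lam i) + -(s i * lam i) := fun i => by
    rw [Real.log_mul (left_ne_zero_of_mul (h0 i (Finset.mem_univ i))) (Real.exp_ne_zero _),
      Real.log_pow, Real.log_exp]
  have h2 : (1 : ℝ) ≤ 2 ^ ∑ i, y i := one_le_pow₀ one_le_two
  have h3 : 0 ≤ ∑ i, |s i * lam i| := Finset.sum_nonneg fun i _ => abs_nonneg _
  have h4 := sum_mul_le_mul_two_pow y (u := fun i => |Real.log (lam i)|) fun i => abs_nonneg _
  calc |∑ i, Real.log (lam i ^ y i * Real.exp (-(s i * lam i)))|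
      ≤ ∑ i, (y i * |Real.log (lam i)| + |s i * lam i|) := by
        refine (Finset.abs_sum_le_sum_abs _ _).trans (Finset.sum_le_sum fun i _ => ?_)
        rw [h1]
        refine (abs_add_le _ _).trans_eq ?_
        rw [abs_mul, abs_neg, Nat.abs_cast]
    _ ≤ _ := by
        rw [Finset.sum_add_distrib, add_mul]
        have := le_mul_of_one_le_right h3 h2
        linarith

section

variable {r s β : Fin d → ℝ}

lemma predictive_priorBeta_pos (hr : ∀ i, 0 < r i) (hs : ∀ i, 0 < s i) (hβ : ∀ i, 0 < β i)
    (x y : Fin d → ℕ) : 0 < predictive r s (priorBeta β) x y := by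
  rw [predictive_priorBeta hr hs hβ]
  exact div_pos (mul_pos (likCoef_pos hs y) (gammaNorm_pos (fun i => add_pos (hr i) (hs i))
    (shape_pos hβ _))) (gammaNorm_pos hr (shape_pos hβ x))

lemma sum_add_apply (x y : Fin d → ℕ) : ∑ i, (x + y) i = ∑ i, x i + ∑ i, y i := by
  simp [Finset.sum_add_distrib]

/-- The factorials cancel in the ratio, leaving powers, exponentials and Gamma factors. Since some
`lam i` may be zero, outcomes of probability zero are excluded. -/
lemma exists_abs_log_ratio_priorBeta_le (hr : ∀ i, 0 < r i) (hs : ∀ i, 0 < s i)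
    (hβ : ∀ i, 0 < β i) (lam : Fin d → ℝ) :
    ∃ C, 0 ≤ C ∧ ∀ x y, poissonLik s lam y ≠ 0 →
      |Real.log (poissonLik s lam y / predictive r s (priorBeta β) x y)| ≤
        C * (2 ^ (∑ i, x i) * 2 ^ ∑ i, y i) := by
  have hrs : ∀ i, 0 < (r + s) i := fun i => add_pos (hr i) (hs i)
  obtain ⟨C₁, hC₁, h₁⟩ := exists_abs_log_gammaNorm_le hr hβ
  obtain ⟨C₂, hC₂, h₂⟩ := exists_abs_log_gammaNorm_le hrs hβ
  set C₃ := ∑ i, |Real.log (lam i)| + ∑ i, |s i * lam i| with hC₃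
  have hC₃' : 0 ≤ C₃ := by positivity
  refine ⟨C₃ + C₁ + C₂, by positivity, fun x y hy => ?_⟩
  have hy0 : ∏ i, lam i ^ y i * Real.exp (-(s i * lam i)) ≠ 0 := by
    rw [poissonLik_eq_likCoef_mul] at hy
    exact right_ne_zero_of_mul hy
  have hN := gammaNorm_pos hr (shape_pos hβ x)
  have hN' := gammaNorm_pos hrs (shape_pos hβ (x + y))
  have heq : poissonLik s lam y / predictive r s (priorBeta β) x y =
      (∏ i, lam i ^ y i * Real.exp (-(s i * lam i))) * gammaNorm r (shape β x) /
        gammaNorm (r + s) (shape β (x + y)) := by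
    rw [predictive_priorBeta hr hs hβ, poissonLik_eq_likCoef_mul]
    have := (likCoef_pos hs y).ne'
    field_simp
  rw [heq, Real.log_div (mul_ne_zero hy0 hN.ne') hN'.ne', Real.log_mul hy0 hN.ne']
  have hX : (1 : ℝ) ≤ 2 ^ ∑ i, x i := one_le_pow₀ one_le_two
  have hY : (1 : ℝ) ≤ 2 ^ ∑ i, y i := one_le_pow₀ one_le_two
  have e1 : |Real.log (∏ i, lam i ^ y i * Real.exp (-(s i * lam i)))| ≤
      C₃ * (2 ^ (∑ i, x i) * 2 ^ ∑ i, y i) :=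
    (abs_log_prod_le hy0).trans (mul_le_mul_of_nonneg_left
      (le_mul_of_one_le_left (by positivity) hX) hC₃')
  have e2 : |Real.log (gammaNorm r (shape β x))| ≤ C₁ * (2 ^ (∑ i, x i) * 2 ^ ∑ i, y i) :=
    (h₁ x).trans (mul_le_mul_of_nonneg_left (le_mul_of_one_le_right (by positivity) hY) hC₁)
  have e3 := h₂ (x + y)
  rw [sum_add_apply, pow_add] at e3
  refine (abs_sub _ _).trans ((add_le_add_left (abs_add_le _ _) _).trans ?_)
  linarith

end

section

variable {r s lam : Fin d → ℝ} {q : (Fin d → ℕ) → (Fin d → ℕ) → ℝ}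

lemma summable_joint_of_le (hr : ∀ i, 0 ≤ r i * lam i) (hs : ∀ i, 0 ≤ s i * lam i)
    {g : (Fin d → ℕ) × (Fin d → ℕ) → ℝ} {C : ℝ}
    (hg : ∀ p, poissonLik s lam p.2 ≠ 0 → |g p| ≤ C * (2 ^ (∑ i, p.1 i) * 2 ^ ∑ i, p.2 i)) :
    Summable fun p : (Fin d → ℕ) × (Fin d → ℕ) =>
      poissonLik r lam p.1 * poissonLik s lam p.2 * g p := by
  have h := ((summable_poissonLik_mul_pow hr zero_le_two).mul_of_nonneg
    (summable_poissonLik_mul_pow hs zero_le_two)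
    (fun z => mul_nonneg (poissonLik_nonneg hr z) (by positivity))
    (fun z => mul_nonneg (poissonLik_nonneg hs z) (by positivity))).mul_left C
  refine Summable.of_norm_bounded h fun p => ?_
  have h1 := poissonLik_nonneg hr p.1
  have h2 := poissonLik_nonneg hs p.2
  rw [norm_mul, Real.norm_of_nonneg (mul_nonneg h1 h2), Real.norm_eq_abs]
  rcases eq_or_ne (poissonLik s lam p.2) 0 with h0 | h0
  · simp [h0]
  · have := mul_le_mul_of_nonneg_left (hg p h0) (mul_nonneg h1 h2)
    linarith

lemma klRisk_eq_tsum (hr : ∀ i, 0 ≤ r i * lam i) (hs : ∀ i, 0 ≤ s i * lam i)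
    (hq : ∀ x y, 0 < q x y) {C : ℝ}
    (hC : ∀ x y, poissonLik s lam y ≠ 0 → |Real.log (poissonLik s lam y / q x y)| ≤
      C * (2 ^ (∑ i, x i) * 2 ^ ∑ i, y i)) :
    KLRiskFinite r s q lam ∧ klRisk r s q lam = ∑' p : (Fin d → ℕ) × (Fin d → ℕ),
      poissonLik r lam p.1 * poissonLik s lam p.2 *
        Real.log (poissonLik s lam p.2 / q p.1 p.2) := by
  have hsum := summable_joint_of_le hr hs
    (g := fun p => Real.log (poissonLik s lam p.2 / q p.1 p.2)) fun p hp => hC p.1 p.2 hp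
  have hinner : ∀ x, Summable fun y =>
      poissonLik s lam y * Real.log (poissonLik s lam y / q x y) := by
    intro x
    refine Summable.of_norm_bounded
      ((summable_poissonLik_mul_pow hs zero_le_two).mul_left (C * 2 ^ ∑ i, x i)) fun y => ?_
    have h2 := poissonLik_nonneg hs y
    rw [norm_mul, Real.norm_of_nonneg h2, Real.norm_eq_abs]
    rcases eq_or_ne (poissonLik s lam y) 0 with h0 | h0
    · simp [h0]
    · have := mul_le_mul_of_nonneg_left (hC x y h0) h2
      linarith
  have hloss : ∀ x, poissonLik r lam x * klLoss (poissonLik s lam) (q x) =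
      ∑' y, poissonLik r lam x * poissonLik s lam y *
        Real.log (poissonLik s lam y / q x y) := fun x => by
    rw [klLoss, ← tsum_mul_left]
    simp_rw [mul_assoc]
  refine ⟨⟨fun x _ => ⟨fun y _ => hq x y, hinner x⟩, ?_⟩, ?_⟩
  · simp_rw [hloss]
    exact hsum.prod
  · rw [klRisk, hsum.tsum_prod]
    exact tsum_congr hloss

end

/-! ### Comparison of the risks. -/

section

variable {r s β w : Fin d → ℝ} {η α δ : ℝ} {θ : (Fin d → ℝ) → Fin d → ℝ}

lemma predictive_priorF_pos (hr : ∀ i, 0 < r i) (hs : ∀ i, 0 < s i) (hβ : ∀ i, 0 < β i)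
    (hη : 0 ≤ η) (hα : 0 < α) (hαβ : α ≤ ∑ i, β i - 1) (hw : ∀ i, 0 < w i)
    (hθ : ∀ lam ∈ posOrthant d, ∀ i, θ lam i ^ 2 = w i * lam i) (x y : Fin d → ℕ) :
    0 < predictive r s (priorF (shiftPoint η α) θ β) x y := by
  rw [predictive_priorF hr hs hβ hη hα hαβ hw hθ]
  exact mul_pos (predictive_priorBeta_pos hr hs hβ x y) (div_pos
    (shrinkInt_pos hη (fun i => div_pos (hw i) (add_pos (hr i) (hs i))) (shape_nonneg hβ _) hα
      (lt_sum_shape hαβ _))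
    (shrinkInt_pos hη (fun i => div_pos (hw i) (hr i)) (shape_nonneg hβ _) hα (lt_sum_shape hαβ _)))

lemma log_ratio_priorF (hr : ∀ i, 0 < r i) (hs : ∀ i, 0 < s i) (hβ : ∀ i, 0 < β i)
    (hη : 0 ≤ η) (hα : 0 < α) (hαβ : α ≤ ∑ i, β i - 1) (hw : ∀ i, 0 < w i)
    (hθ : ∀ lam ∈ posOrthant d, ∀ i, θ lam i ^ 2 = w i * lam i) (x y : Fin d → ℕ) {u : ℝ}
    (hu : u ≠ 0) :
    Real.log (u / predictive r s (priorF (shiftPoint η α) θ β) x y) =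
      Real.log (u / predictive r s (priorBeta β) x y) -
        (logShrink η α (fun i => w i / (r i + s i)) β (x + y) -
          logShrink η α (fun i => w i / r i) β x) := by
  have h1 := predictive_priorBeta_pos hr hs hβ x y
  have h2 := shrinkInt_pos hη (fun i => div_pos (hw i) (add_pos (hr i) (hs i)))
    (shape_nonneg hβ (x + y)) hα (lt_sum_shape hαβ (x + y))
  have h3 := shrinkInt_pos hη (fun i => div_pos (hw i) (hr i))
    (shape_nonneg hβ x) hα (lt_sum_shape hαβ x)
  rw [predictive_priorF hr hs hβ hη hα hαβ hw hθ, ← div_div,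
    Real.log_div (div_ne_zero hu h1.ne') (div_pos h2 h3).ne', Real.log_div h2.ne' h3.ne']
  rfl

/-- Lets `(r, lam)` be traded for `(1 / c, μ)` with `c i = w i / r i` and `μ i = w i * lam i`. -/
lemma poissonLik_congr {t t' lam lam' : Fin d → ℝ} (h : ∀ i, t i * lam i = t' i * lam' i) :
    poissonLik t lam = poissonLik t' lam' := by
  funext z
  simp only [poissonLik, h]

lemma klRisk_priorF_lt (hr : ∀ i, 0 < r i) (hs : ∀ i, 0 < s i) (hβ : ∀ i, 0 < β i)
    (hη : 0 ≤ η) (hα : 0 < α) (hαβ : α ≤ ∑ i, β i - 1) (hw : ∀ i, 0 < w i)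
    (hθ : ∀ lam ∈ posOrthant d, ∀ i, θ lam i ^ 2 = w i * lam i) (hδ : 0 < δ)
    (hwδ : ∀ i, w i / r i = w i / (r i + s i) + δ) {lam : Fin d → ℝ} (hlam : ∀ i, 0 ≤ lam i) :
    KLRiskFinite r s (predictive r s (priorF (shiftPoint η α) θ β)) lam ∧
      KLRiskFinite r s (predictive r s (priorBeta β)) lam ∧
      klRisk r s (predictive r s (priorF (shiftPoint η α) θ β)) lam <
        klRisk r s (predictive r s (priorBeta β)) lam := by
  have hc : ∀ i, 0 < w i / r i := fun i => div_pos (hw i) (hr i)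
  have hc' : ∀ i, 0 < w i / (r i + s i) := fun i => div_pos (hw i) (add_pos (hr i) (hs i))
  have hrl : ∀ i, 0 ≤ r i * lam i := fun i => mul_nonneg (hr i).le (hlam i)
  have hsl : ∀ i, 0 ≤ s i * lam i := fun i => mul_nonneg (hs i).le (hlam i)
  obtain ⟨C, hC0, hC⟩ := exists_abs_log_ratio_priorBeta_le hr hs hβ lam
  obtain ⟨C₁, hC₁, h₁⟩ := exists_abs_log_shrinkInt_le hη hc hβ hα hαβ
  obtain ⟨C₂, hC₂, h₂⟩ := exists_abs_log_shrinkInt_le hη hc' hβ hα hαβ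
  have hb₁ : ∀ x y : Fin d → ℕ, |logShrink η α (fun i => w i / r i) β x| ≤
      C₁ * (2 ^ (∑ i, x i) * 2 ^ ∑ i, y i) := fun x y =>
    (h₁ x).trans (mul_le_mul_of_nonneg_left
      (le_mul_of_one_le_right (by positivity) (one_le_pow₀ one_le_two)) hC₁)
  have hb₂ : ∀ x y : Fin d → ℕ, |logShrink η α (fun i => w i / (r i + s i)) β (x + y)| ≤
      C₂ * (2 ^ (∑ i, x i) * 2 ^ ∑ i, y i) := fun x y => by
    rw [← pow_add, ← sum_add_apply]
    exact h₂ (x + y)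
  have hCF : ∀ x y, poissonLik s lam y ≠ 0 →
      |Real.log (poissonLik s lam y / predictive r s (priorF (shiftPoint η α) θ β) x y)| ≤
        (C + (C₂ + C₁)) * (2 ^ (∑ i, x i) * 2 ^ ∑ i, y i) := fun x y hy => by
    rw [log_ratio_priorF hr hs hβ hη hα hαβ hw hθ x y hy, add_mul, add_mul]
    exact (abs_sub _ _).trans (add_le_add (hC x y hy)
      ((abs_sub _ _).trans (add_le_add (hb₂ x y) (hb₁ x y))))
  obtain ⟨hfin, heq⟩ := klRisk_eq_tsum hrl hsl (predictive_priorBeta_pos hr hs hβ) hC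
  obtain ⟨hfinF, heqF⟩ := klRisk_eq_tsum hrl hsl
    (predictive_priorF_pos hr hs hβ hη hα hαβ hw hθ) hCF
  refine ⟨hfinF, hfin, ?_⟩
  have hsum := summable_joint_of_le hrl hsl (g := fun p => Real.log (poissonLik s lam p.2 /
    predictive r s (priorBeta β) p.1 p.2)) fun p hp => hC p.1 p.2 hp
  have hsum₁ := summable_joint_of_le hrl hsl (g := fun p =>
    logShrink η α (fun i => w i / r i) β p.1) fun p _ => hb₁ p.1 p.2
  have hsum₂ := summable_joint_of_le hrl hsl (g := fun p =>
    logShrink η α (fun i => w i / (r i + s i)) β (p.1 + p.2)) fun p _ => hb₂ p.1 p.2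
  have hpt : ∀ p : (Fin d → ℕ) × (Fin d → ℕ), poissonLik r lam p.1 * poissonLik s lam p.2 *
      Real.log (poissonLik s lam p.2 / predictive r s (priorF (shiftPoint η α) θ β) p.1 p.2) =
      poissonLik r lam p.1 * poissonLik s lam p.2 *
        Real.log (poissonLik s lam p.2 / predictive r s (priorBeta β) p.1 p.2) -
      (poissonLik r lam p.1 * poissonLik s lam p.2 *
        logShrink η α (fun i => w i / (r i + s i)) β (p.1 + p.2) -
      poissonLik r lam p.1 * poissonLik s lam p.2 * logShrink η α (fun i => w i / r i) β p.1) := by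
    intro p
    rcases eq_or_ne (poissonLik s lam p.2) 0 with h0 | h0
    · simp [h0]
    · rw [log_ratio_priorF hr hs hβ hη hα hαβ hw hθ p.1 p.2 h0]
      ring
  rw [heqF, heq, tsum_congr hpt, hsum.tsum_sub (hsum₂.sub hsum₁), hsum₂.tsum_sub hsum₁,
    tsum_poissonLik_mul_poissonLik r s lam _ hsum₂]
  -- This term ignores `y`, whose probabilities sum to one.
  have hfst : ∑' p : (Fin d → ℕ) × (Fin d → ℕ), poissonLik r lam p.1 * poissonLik s lam p.2 *
      logShrink η α (fun i => w i / r i) β p.1 =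
      ∑' x, poissonLik r lam x * logShrink η α (fun i => w i / r i) β x := by
    rw [hsum₁.tsum_prod]
    refine tsum_congr fun x => ?_
    dsimp only
    rw [tsum_mul_right, tsum_mul_left, (hasSum_poissonLik hsl).tsum_eq, mul_one]
  have key := tsum_poissonLik_logShrink_lt hη hα hαβ hc' hβ
    (fun i => mul_nonneg (hw i).le (hlam i)) hδ
  simp_rw [← hwδ] at key
  have hP : poissonLik (fun i => w i / r i)⁻¹ (fun i => w i * lam i) = poissonLik r lam :=
    poissonLik_congr fun i => by
      have := (hw i).ne'
      have := (hr i).ne'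
      simp only [Pi.inv_apply]
      field_simp
  have hP' : poissonLik (fun i => w i / (r i + s i))⁻¹ (fun i => w i * lam i) =
      poissonLik (r + s) lam :=
    poissonLik_congr fun i => by
      have := (hw i).ne'
      have := (add_pos (hr i) (hs i)).ne'
      simp only [Pi.inv_apply, Pi.add_apply]
      field_simp
  rw [hP, hP'] at key
  rw [hfst]
  linarith

/-- The shrinkage prior `(∑ w i λ i + η) ^ (-α) ∏ λ i ^ (β i - 1)` improves on the prior
`∏ λ i ^ (β i - 1)` as soon as `w i (1 / r i - 1 / (r i + s i))` does not depend on `i`. -/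
theorem posteriorExists_and_dominates (hr : ∀ i, 0 < r i) (hs : ∀ i, 0 < s i) (hβ : ∀ i, 0 < β i)
    (hη : 0 ≤ η) (hα : 0 < α) (hαβ : α ≤ ∑ i, β i - 1) (hw : ∀ i, 0 < w i)
    (hθ : ∀ lam ∈ posOrthant d, ∀ i, θ lam i ^ 2 = w i * lam i) (hδ : 0 < δ)
    (hwδ : ∀ i, w i / r i = w i / (r i + s i) + δ) :
    PosteriorExists r (priorBeta β) ∧ PosteriorExists r (priorF (shiftPoint η α) θ β) ∧
      Dominates r s (predictive r s (priorF (shiftPoint η α) θ β))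
        (predictive r s (priorBeta β)) := by
  -- The inequality is strict at every `lam` of the closed orthant; the all-ones vector is an
  -- arbitrary interior witness.
  refine ⟨posteriorExists_priorBeta hr hβ, posteriorExists_priorF hr hβ hη hα hαβ hw hθ,
    fun lam hlam => ?_, fun _ => 1, fun _ => one_pos, ?_⟩
  · obtain ⟨h1, h2, h3⟩ := klRisk_priorF_lt hr hs hβ hη hα hαβ hw hθ hδ hwδ hlam
    exact ⟨h1, h2, h3.le⟩
  · exact (klRisk_priorF_lt hr hs hβ hη hα hαβ hw hθ hδ hwδ fun _ => zero_le_one).2.2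

end

lemma gam_pos {r s : Fin d → ℝ} (hr : ∀ i, 0 < r i) (hs : ∀ i, 0 < s i) (i : Fin d) :
    0 < gam r s i :=
  sub_pos.2 (one_div_lt_one_div_of_lt (hr i) (by linarith [hs i]))

end PoissonPrediction

theorem mainTheorem10 (d : ℕ) (β : Fin d → ℝ) (hβ : ∀ i, 0 < β i) (η α : ℝ) (hη : 0 ≤ η)
    (hα : 0 < α) (hαβ : α ≤ ∑ i, β i - 1) :
    -- the same durations `r` and `s` in all coordinates, with `θ_i = √λ_i`
    (∀ r s : ℝ, 0 < r → 0 < s →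
      PoissonPrediction.PosteriorExists (fun _ => r) (PoissonPrediction.priorBeta β) ∧
      PoissonPrediction.PosteriorExists (fun _ => r)
        (PoissonPrediction.priorF (PoissonPrediction.shiftPoint η α)
          PoissonPrediction.thetaSame β) ∧
      PoissonPrediction.Dominates (fun _ => r) (fun _ => s)
        (PoissonPrediction.predictive (fun _ => r) (fun _ => s)
          (PoissonPrediction.priorF (PoissonPrediction.shiftPoint η α)
            PoissonPrediction.thetaSame β))
        (PoissonPrediction.predictive (fun _ => r) (fun _ => s)
          (PoissonPrediction.priorBeta β))) ∧
    -- arbitrary durations `r_i` and `s_i`, with `θ_i = √(λ_i / γ_i)`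
    (∀ r s : Fin d → ℝ, (∀ i, 0 < r i) → (∀ i, 0 < s i) →
      PoissonPrediction.PosteriorExists r (PoissonPrediction.priorBeta β) ∧
      PoissonPrediction.PosteriorExists r
        (PoissonPrediction.priorF (PoissonPrediction.shiftPoint η α)
          (PoissonPrediction.thetaDiff r s) β) ∧
      PoissonPrediction.Dominates r s
        (PoissonPrediction.predictive r s
          (PoissonPrediction.priorF (PoissonPrediction.shiftPoint η α)
            (PoissonPrediction.thetaDiff r s) β))
        (PoissonPrediction.predictive r s (PoissonPrediction.priorBeta β))) := by
  refine ⟨fun r s hr hs => ?_, fun r s hr hs => ?_⟩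
  · refine PoissonPrediction.posteriorExists_and_dominates (w := fun _ => 1)
      (δ := 1 / r - 1 / (r + s)) (fun _ => hr) (fun _ => hs) hβ hη hα hαβ (fun _ => one_pos)
      (fun lam hlam i => ?_) (sub_pos.2 (one_div_lt_one_div_of_lt hr (by linarith)))
      (fun i => by ring)
    rw [PoissonPrediction.thetaSame, Real.sq_sqrt (hlam i).le, one_mul]
  · have hγ := PoissonPrediction.gam_pos hr hs
    refine PoissonPrediction.posteriorExists_and_dominates
      -- The weights `1 / γ_i` equalize the gaps `w_i (1 / r_i - 1 / (r_i + s_i))`, making each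
      -- equal to `1`.
      (w := fun i => (PoissonPrediction.gam r s i)⁻¹) (δ := 1) hr hs hβ hη hα hαβ
      (fun i => inv_pos.2 (hγ i)) (fun lam hlam i => ?_) one_pos (fun i => ?_)
    · rw [PoissonPrediction.thetaDiff, Real.sq_sqrt (div_pos (hlam i) (hγ i)).le, div_eq_inv_mul]
    · have h := inv_mul_cancel₀ (hγ i).ne'
      have h' : PoissonPrediction.gam r s i = 1 / r i - 1 / (r i + s i) := rfl
      -- With `γ` opaque, the constant `1` is written as `γ⁻¹ * γ` and only that uninverted `γ` is
      -- expanded, so `ring` treats `γ⁻¹` as an atom.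
      generalize PoissonPrediction.gam r s i = γ at *
      rw [← h]
      nth_rewrite 4 [h']
      ring
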